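/- Let $m\ge 1$ be an integer, $\mathbb I=[0,1]$, and let $S^m(\mathbb I)$ be the set of $f\in L^2(\mathbb I)$ whose derivatives $f^{(j)}$, $0\le j\le m-1$, are absolutely continuous and for which $f^{(m)}\in L^2(\mathbb I)$, with the $\sigma$-algebra generated by the evaluations $f\mapsto f(t)$, $t\in\mathbb I$. Let $A:\mathbb R\to\mathbb R$ be three times continuously differentiable with $\ddot A>0$, let $f_0\in S^m(\mathbb I)$, and let $\pi$ be a probability density on $\mathbb I$ that is bounded above and bounded away from $0$. For $f,g\in S^m(\mathbb I)$ put $$V(f,g)=\int_0^1\ddot A(f_0(x))f(x)g(x)\pi(x)\,dx,\qquad U(f,g)=\int_0^1 f^{(m)}(x)g^{(m)}(x)\,dx,\qquad J(f,g)=V(f^\dagger,g^\dagger)+U(f,g),$$ where $f^\dagger$ is the $V$-orthogonal projection of $f$ onto $\{g\in S^m(\mathbb I):U(g,g)=0\}$; and for $\lambda>0$ put $\|f\|^2=V(f,f)+\lambda J(f,f)$. Let $(\varphi_\nu,\rho_\nu)_{\nu\ge1}$ be the eigen-system of $(V,U)$ on $S^m(\mathbb I)$: the $\varphi_\nu\in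 S^m(\mathbb I)$ satisfy $U(\varphi_\nu,h)=\rho_\nu V(\varphi_\nu,h)$ for all $h\in S^m(\mathbb I)$ and $V(\varphi_\mu,\varphi_\nu)=\delta_{\mu\nu}$, the $\rho_\nu$ are nondecreasing, and every eigenfunction (every $g\in S^m(\mathbb I)$ with $U(g,\cdot)=rV(g,\cdot)$ on $S^m(\mathbb I)$ for some real $r$) is a finite linear combination of the $\varphi_\nu$. Let $\beta>1$ and $\sigma_1,\dots,\sigma_m>0$. Put $\tau_\nu^2=\sigma_\nu^{-2}$ and $\gamma_\nu=1$ for $\nu\le m$, and $\tau_\nu^2=\rho_\nu^{1+\beta/(2m)}$ and $\gamma_\nu=\rho_\nu$ for $\nu>m$. Let $n\ge1$, let $(Y_i,X_i)\in\mathbb R\times\mathbb I$, $1\le i\le n$, be the observed sample (any fixed data), and let $\widehat f_{n,\lambda}$ be a maximizer over $f\in S^m(\mathbb I)$ of $$\ell_{n,\lambda}(f)=\frac1n\sum_{i=1}^n\bigl[Y_if(X_i)-A(f(X_i))\bigr]-\frac{\lambda}{2}J(f,f).$$ Write $\widehat f_\nu=V(\widehat f_{n,\lambda},\varphi_\nu)$,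 $a_{n,\nu}=n(1+\lambda\gamma_\nu)\bigl(\tau_\nu^2+n(1+\lambda\gamma_\nu)\bigr)^{-1}$ and $b_{n,\nu}=\bigl(\tau_\nu^2+n(1+\lambda\gamma_\nu)\bigr)^{-1/2}$. Let $v_1,v_2,\dots$ be independent random variables with $v_\nu\sim N(0,\tau_\nu^{-2})$, and let $$G=\sum_{\nu\ge1}v_\nu\varphi_\nu,\qquad W=\sum_{\nu\ge1}\bigl(a_{n,\nu}\widehat f_\nu+b_{n,\nu}\tau_\nu v_\nu\bigr)\varphi_\nu .$$ Then, almost surely, both series converge at every point of $\mathbb I$ and $G,W\in S^m(\mathbb I)$, so that $G$ and $W$ induce probability measures $\Pi$ and $\Pi_W$ on $S^m(\mathbb I)$. The function $f\mapsto\exp(-\frac n2\|f-\widehat f_{n,\lambda}\|^2)$ is measurable and $\Pi$-integrable with a positive integral, $\Pi_W$ is absolutely continuous with respect to $\Pi$, and, $\Pi$-almost everywhere, $$\frac{d\Pi_W}{d\Pi}(f)=\frac{\exp\bigl(-\frac n2\|f-\widehat f_{n,\lambda}\|^2\bigr)}{\int_{S^m(\mathbb I)}\exp\bigl(-\frac n2\|g-\widehat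 f_{n,\lambda}\|^2\bigr)\,d\Pi(g)} .$$ Consequently the pseudo-posterior $$P_0(B)=\frac{\int_B\exp\bigl(-\frac n2\|f-\widehat f_{n,\lambda}\|^2\bigr)\,d\Pi(f)}{\int_{S^m(\mathbb I)}\exp\bigl(-\frac n2\|f-\widehat f_{n,\lambda}\|^2\bigr)\,d\Pi(f)}$$ is absolutely continuous with respect to $\Pi$, satisfies $dP_0/d\Pi=d\Pi_W/d\Pi$ $\Pi$-almost everywhere, and $P_0=\Pi_W$. -/

import Mathlib

open MeasureTheory ProbabilityTheory Set
open scoped unitInterval ENNReal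

noncomputable section

namespace SplineBayes

/-- The `j`-th derivative on `[0,1]` (one-sided at the end points) of a function on `[0,1]`.
Only the values of `f` on `[0,1]` matter. -/
def D (j : ℕ) (f : I → ℝ) : ℝ → ℝ :=
  iteratedDerivWithin j (IccExtend zero_le_one f) (Icc (0 : ℝ) 1)

/-- Membership in the Sobolev space `S^m([0,1])`: `f ∈ L²`, the derivatives of order
`0, …, m - 1` are absolutely continuous on `[0,1]`, and the `m`-th derivative is in `L²`. -/
structure MemSobolev (m : ℕ) (f : I → ℝ) : Prop where
  memLp : MemLp f 2 volume
  absCont : ∀ j < m, AbsolutelyContinuousOnInterval (D j f) 0 1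
  memLp_deriv : MemLp (D m f) 2 (volume.restrict (Icc (0 : ℝ) 1))

/-- The zero function belongs to `S^m([0,1])`. -/
theorem memSobolev_zero (m : ℕ) : MemSobolev m (0 : I → ℝ) := by
  have hD : ∀ j, D j (0 : I → ℝ) = fun _ => 0 := by
    intro j
    have h0 : IccExtend (zero_le_one : (0 : ℝ) ≤ 1) (0 : I → ℝ) = fun _ => (0 : ℝ) := rfl
    unfold D
    rw [h0]
    funext x
    simp
  refine ⟨MemLp.zero, fun j _ => ?_, ?_⟩
  · rw [hD j]
    have h := (LipschitzWith.const (0 : ℝ) : LipschitzWith 0 (fun _ : ℝ => (0 : ℝ)))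
    exact (h.lipschitzOnWith (s := uIcc 0 1)).absolutelyContinuousOnInterval
  · rw [hD m]
    exact MemLp.zero

/-- The Sobolev space `S^m([0,1])` as a type. -/
def Sobolev (m : ℕ) : Type := {f : I → ℝ // MemSobolev m f}

/-- The `σ`-algebra on `S^m([0,1])` generated by the evaluations `f ↦ f t`, `t ∈ [0,1]`. -/
instance (m : ℕ) : MeasurableSpace (Sobolev m) :=
  MeasurableSpace.comap (fun f => f.1) (MeasurableSpace.pi (X := fun _ : I => ℝ))

/-- The ingredients of the regression model `p_f(y,x) = exp (y f(x) - A (f x) + c(y,x)) π(x)`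
that enter the construction: the function `A`, the true parameter `f₀`, and the density `π` of
the covariate. -/
structure Model (m : ℕ) where
  A : ℝ → ℝ
  contDiff_A : ContDiff ℝ 3 A
  deriv2_A_pos : ∀ z, 0 < deriv (deriv A) z
  f₀ : I → ℝ
  mem_f₀ : MemSobolev m f₀
  dens : I → ℝ
  measurable_dens : Measurable dens
  dens_lower : ∃ c : ℝ, 0 < c ∧ ∀ x, c ≤ dens x
  dens_upper : ∃ c : ℝ, ∀ x, dens x ≤ c
  integral_dens : ∫ x, dens x = 1

variable {m : ℕ} (M : Model m)

/-- `V(f,g) = E [A''(f₀(X)) f(X) g(X)]`, where `X` has density `π` on `[0,1]`. -/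
def Model.V (f g : I → ℝ) : ℝ :=
  ∫ x, deriv (deriv M.A) (M.f₀ x) * f x * g x * M.dens x

/-- `U(f,g) = ∫₀¹ f^{(m)} g^{(m)}`. -/
def U (m : ℕ) (f g : I → ℝ) : ℝ :=
  ∫ x in Icc (0 : ℝ) 1, D m f x * D m g x

/-- `p` is the projection of `f` onto the null space `{g ∈ S^m : U(g,g) = 0}` of `U`, orthogonal
with respect to `V`. -/
def Model.IsNullProj (f p : I → ℝ) : Prop :=
  (MemSobolev m p ∧ U m p p = 0) ∧
    ∀ q, MemSobolev m q → U m q q = 0 → M.V (fun t => f t - p t) q = 0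

/-- The projection `f†` of `f` onto the null space of `U` (it exists and is unique for every
`f ∈ S^m` when `m ≥ 1`). -/
def Model.dagger (f : I → ℝ) : I → ℝ := Classical.epsilon (M.IsNullProj f)

/-- The roughness penalty `J(f,g) = V(f†,g†) + U(f,g)`. -/
def Model.J (f g : I → ℝ) : ℝ := M.V (M.dagger f) (M.dagger g) + U m f g

/-- The squared norm `‖f‖² = V(f,f) + λ J(f,f)`. -/
def Model.normSq (lam : ℝ) (f : I → ℝ) : ℝ := M.V f f + lam * M.J f f

/-- The penalized log-likelihood of the sample `(y i, x i)`, `i < n`. -/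
def Model.penLik (lam : ℝ) {n : ℕ} (y : Fin n → ℝ) (x : Fin n → I) (f : I → ℝ) : ℝ :=
  (1 / (n : ℝ)) * ∑ i, (y i * f (x i) - M.A (f (x i))) - lam / 2 * M.J f f

/-- `fhat` is a smoothing spline estimate: a maximizer over `S^m` of the penalized
log-likelihood. -/
def Model.IsSplineEstimate (lam : ℝ) {n : ℕ} (y : Fin n → ℝ) (x : Fin n → I)
    (fhat : I → ℝ) : Prop :=
  MemSobolev m fhat ∧
    ∀ f, MemSobolev m f → M.penLik lam y x f ≤ M.penLik lam y x fhat

/-- `g ∈ S^m` satisfies `U(g,h) = r V(g,h)` for all `h ∈ S^m`. This is the weak form of the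
boundary value problem `(-1)^m g^{(2m)} = r A''(f₀) π g`, `g^{(j)}(0) = g^{(j)}(1) = 0` for
`m ≤ j ≤ 2m - 1`. -/
def Model.IsEigen (r : ℝ) (g : I → ℝ) : Prop :=
  MemSobolev m g ∧ ∀ h, MemSobolev m h → U m g h = r * M.V g h

/-- `(φ ν, ρ ν)`, `ν = 0, 1, 2, …`, is the eigen-system of the pair of forms `(V, U)` on `S^m`:
a `V`-orthonormal list of all eigenfunctions (up to finite linear combinations), with the
eigenvalues in nondecreasing order. The index `ν` here stands for `ν + 1` in the usual numbering
`1, 2, 3, …`. -/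
structure Model.IsEigenSystem (φ : ℕ → I → ℝ) (ρ : ℕ → ℝ) : Prop where
  isEigen : ∀ ν, M.IsEigen (ρ ν) (φ ν)
  orthonormal : ∀ μ ν, M.V (φ μ) (φ ν) = if μ = ν then 1 else 0
  monotone : Monotone ρ
  exhaustive : ∀ r g, M.IsEigen r g → g ∈ Submodule.span ℝ (range φ)

/-- `τ_ν²`: equal to `σ_ν⁻²` (`sd ν = σ_ν`) for the first `m` indices and to `ρ_ν ^ (1 + β / (2 m))` after
them. -/
def tauSq (m : ℕ) (sd ρ : ℕ → ℝ) (β : ℝ) (ν : ℕ) : ℝ :=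
  if ν < m then ((sd ν) ^ 2)⁻¹ else ρ ν ^ (1 + β / (2 * (m : ℝ)))

/-- `γ_ν`: equal to `1` for the first `m` indices and to `ρ_ν` after them. -/
def gam (m : ℕ) (ρ : ℕ → ℝ) (ν : ℕ) : ℝ := if ν < m then 1 else ρ ν

/-- `a_{n,ν} = n (1 + λ γ_ν) / (τ_ν² + n (1 + λ γ_ν))`. -/
def aCoef (m : ℕ) (sd ρ : ℕ → ℝ) (β lam : ℝ) (n ν : ℕ) : ℝ :=
  (n : ℝ) * (1 + lam * gam m ρ ν) / (tauSq m sd ρ β ν + (n : ℝ) * (1 + lam * gam m ρ ν))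

/-- `b_{n,ν} = (τ_ν² + n (1 + λ γ_ν))^{-1/2}`. -/
def bCoef (m : ℕ) (sd ρ : ℕ → ℝ) (β lam : ℝ) (n ν : ℕ) : ℝ :=
  (Real.sqrt (tauSq m sd ρ β ν + (n : ℝ) * (1 + lam * gam m ρ ν)))⁻¹

/-- The coefficient `a_{n,ν} f̂_ν + b_{n,ν} τ_ν v_ν` of the process `W`, where
`f̂_ν = V(f̂, φ_ν)` is the Fourier coefficient of `f̂`. -/
def Model.wCoef (φ : ℕ → I → ℝ) (ρ sd : ℕ → ℝ) (β lam : ℝ) (n : ℕ) (fhat : I → ℝ)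
    {Ω : Type*} (v : ℕ → Ω → ℝ) (ν : ℕ) (ω : Ω) : ℝ :=
  aCoef m sd ρ β lam n ν * M.V fhat (φ ν)
    + bCoef m sd ρ β lam n ν * Real.sqrt (tauSq m sd ρ β ν) * v ν ω

/-- The random series `∑_ν c_ν φ_ν(t)` with random coefficients `c_ν`. -/
def process (φ : ℕ → I → ℝ) {Ω : Type*} (c : ℕ → Ω → ℝ) (ω : Ω) (t : I) : ℝ :=
  ∑' ν, c ν ω * φ ν t

open Classical in
/-- A random function regarded as a random element of `S^m`; it is set to zero on the event
that its path is not in `S^m`. -/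
def toSobolev (m : ℕ) {Ω : Type*} (X : Ω → I → ℝ) (ω : Ω) : Sobolev m :=
  if h : MemSobolev m (X ω) then ⟨X ω, h⟩ else ⟨0, memSobolev_zero m⟩

/-- The measure on `S^m` induced by a random function `X` whose paths lie in `S^m` almost
surely: `B ↦ P (X ∈ B)`. -/
def inducedMeasure (m : ℕ) {Ω : Type*} [MeasurableSpace Ω] (P : Measure Ω) (X : Ω → I → ℝ) :
    Measure (Sobolev m) :=
  P.map (toSobolev m X)

/-- The function `f ↦ exp (-(n/2) ‖f - f̂‖²)` on `S^m`. -/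
def Model.expWeight (lam : ℝ) (n : ℕ) (fhat : I → ℝ) (f : Sobolev m) : ℝ :=
  Real.exp (-((n : ℝ) / 2) * M.normSq lam (fun t => f.1 t - fhat t))

/-- The pseudo-posterior
`P₀(B) = (∫_B exp (-(n/2) ‖f - f̂‖²) dΠ(f)) / ∫ exp (-(n/2) ‖f - f̂‖²) dΠ(f)`. -/
def Model.pseudoPosterior (lam : ℝ) (n : ℕ) (fhat : I → ℝ) (Pi : Measure (Sobolev m)) :
    Measure (Sobolev m) :=
  (∫⁻ f, ENNReal.ofReal (M.expWeight lam n fhat f) ∂Pi)⁻¹ •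
    Pi.withDensity (fun f => ENNReal.ofReal (M.expWeight lam n fhat f))

end SplineBayes

end

/-! Everything happens in the coordinates `x ν` of a function `∑ x ν φ ν`. There the prior is a
product of the laws N(0, τ_ν⁻²). Since `V` becomes the identity, `U` the diagonal form with entries
`ρ ν`, and `f†` keeps the first `m` coordinates, the exponent -(n/2)‖f - f̂‖² is a constant minus ½
∑ n(1 + λγ_ν)(x_ν - f̂_ν)². In one coordinate, completing the square turns the tilted prior into
N(a_{n,ν} f̂_ν, b_{n,ν}²), the law of the coefficient of `W`. Completeness of the eigen-system in
S^m is not needed: whatever part of ‖f̂‖² the eigen-series of `f̂` misses only changes the constant,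
which normalization removes (`exists_hasSum_normSq_sub`).

The passage to infinitely many coordinates is `withDensity_infinitePi`: partial products of the
tilts lie in [0,1] and converge almost surely to a positive limit, so dominated convergence applies
on every cylinder.

The analytic work is to return to S^m. The condition ∑ (1 + ρ_ν) x_ν² < ∞ (`goodCoef`) makes the
series converge to an element of S^m: a Sobolev inequality handles derivatives of order below `m`,
and orthogonality in L² handles order `m` (`exists_sobolev_bound`, `exists_chain`). The condition
holds almost surely because its expectation ∑ (1 + ρ_ν) τ_ν⁻² is bounded, up to finitely many terms,
by a multiple of ∑ ν^(-β). This rests on ρ_ν ≥ c ν^(2m) (`exists_growth`), obtained from a dimension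
count and a Poincaré inequality on a grid. That the first `m` eigenvalues vanish and their
eigenfunctions span the null space of `U` (`rho_eq_zero`, `null_eq_sum`) follows by comparison with
polynomials of degree below `m`. -/

/-! ### Chains of primitives and the space S^m -/

namespace SplineBayes

/-- `g 0, …, g m` are functions on `[0,1]`, each the primitive of the next, the last one in `L²`. -/
structure IsPrimitiveChain (m : ℕ) (g : ℕ → ℝ → ℝ) : Prop where
  integrableOn : ∀ j < m, IntegrableOn (g (j + 1)) (Icc (0 : ℝ) 1)
  memLp : MemLp (g m) 2 (volume.restrict (Icc (0 : ℝ) 1))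
  ftc : ∀ j < m, ∀ x ∈ Icc (0 : ℝ) 1, g j x = g j 0 + ∫ t in (0 : ℝ)..x, g (j + 1) t

lemma intervalIntegrable_of_integrableOn_Icc {g : ℝ → ℝ} (h : IntegrableOn g (Icc (0 : ℝ) 1))
    {a b : ℝ} (ha : a ∈ Icc (0 : ℝ) 1) (hb : b ∈ Icc (0 : ℝ) 1) :
    IntervalIntegrable g volume a b := by
  rw [intervalIntegrable_iff]
  refine h.mono_set (uIoc_subset_uIcc.trans ?_)
  exact OrdConnected.uIcc_subset ordConnected_Icc ha hb

lemma D_zero_apply (f : I → ℝ) (t : I) : D 0 f t = f t := by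
  simp [D]

lemma D_succ (j : ℕ) (f : I → ℝ) : D (j + 1) f = derivWithin (D j f) (Icc (0 : ℝ) 1) := by
  simp only [D, iteratedDerivWithin_succ]

lemma derivWithin_Icc_eq_deriv {g : ℝ → ℝ} {x : ℝ} (hx : x ∈ Ioo (0 : ℝ) 1) :
    derivWithin g (Icc (0 : ℝ) 1) x = deriv g x :=
  derivWithin_of_mem_nhds (Icc_mem_nhds hx.1 hx.2)

lemma ae_restrict_Icc_of_Ioo {p : ℝ → Prop} (h : ∀ᵐ x, x ∈ Ioo (0 : ℝ) 1 → p x) :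
    ∀ᵐ x ∂(volume.restrict (Icc (0 : ℝ) 1)), p x := by
  rw [← restrict_Ioo_eq_restrict_Icc]
  exact (ae_restrict_iff' measurableSet_Ioo).2 h

/-- The derivatives of a function in the Sobolev space form a chain of primitives. -/
lemma MemSobolev.isPrimitiveChain {m : ℕ} {f : I → ℝ} (hf : MemSobolev m f) :
    IsPrimitiveChain m (fun j => D j f) := by
  have hae : ∀ j, D (j + 1) f =ᵐ[volume.restrict (Icc (0 : ℝ) 1)] deriv (D j f) := fun j =>
    ae_restrict_Icc_of_Ioo (.of_forall fun x hx => by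
      rw [D_succ, derivWithin_Icc_eq_deriv hx])
  refine ⟨fun j hj => ?_, hf.memLp_deriv, fun j hj x hx => ?_⟩
  · have h := (hf.absCont j hj).intervalIntegrable_deriv
    rw [intervalIntegrable_iff, uIoc_of_le zero_le_one, ← integrableOn_Icc_iff_integrableOn_Ioc] at h
    exact h.congr (hae j).symm
  · have h := ((hf.absCont j hj).mono (c := 0) (d := x) (by
      rw [uIcc_of_le zero_le_one, uIcc_of_le hx.1]; exact Icc_subset_Icc le_rfl hx.2)).integral_deriv_eq_sub
    have h2 : ∫ t in (0 : ℝ)..x, D (j + 1) f t = ∫ t in (0 : ℝ)..x, deriv (D j f) t := by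
      rw [intervalIntegral.integral_of_le hx.1, intervalIntegral.integral_of_le hx.1]
      refine integral_congr_ae (ae_restrict_of_ae_restrict_of_subset ?_ (hae j))
      exact Ioc_subset_Icc_self.trans (Icc_subset_Icc le_rfl hx.2)
    rw [h2, h]; ring

namespace IsPrimitiveChain

variable {m : ℕ} {g g' : ℕ → ℝ → ℝ}

lemma absCont (hg : IsPrimitiveChain m g) {j : ℕ} (hj : j < m) :
    AbsolutelyContinuousOnInterval (fun x => g j 0 + ∫ t in (0 : ℝ)..x, g (j + 1) t) 0 1 := by
  have h1 : AbsolutelyContinuousOnInterval (fun _ : ℝ => g j 0) 0 1 :=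
    ((LipschitzWith.const (g j 0) : LipschitzWith 0 (fun _ : ℝ => g j 0)).lipschitzOnWith
      (s := uIcc 0 1)).absolutelyContinuousOnInterval
  exact h1.add (IntervalIntegrable.absolutelyContinuousOnInterval_intervalIntegral
    (intervalIntegrable_of_integrableOn_Icc (hg.integrableOn j hj) (by simp) (by simp)) (by simp))

lemma continuousOn (hg : IsPrimitiveChain m g) {j : ℕ} (hj : j < m) :
    ContinuousOn (g j) (Icc (0 : ℝ) 1) := by
  have h := (hg.absCont hj).continuousOn
  rw [uIcc_of_le zero_le_one] at h
  exact h.congr fun x hx => hg.ftc j hj x hx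

lemma ftc' (hg : IsPrimitiveChain m g) {j : ℕ} (hj : j < m) {a x : ℝ} (ha : a ∈ Icc (0 : ℝ) 1)
    (hx : x ∈ Icc (0 : ℝ) 1) : g j x = g j a + ∫ t in a..x, g (j + 1) t := by
  have hi := hg.integrableOn j hj
  rw [hg.ftc j hj x hx, hg.ftc j hj a ha, ← intervalIntegral.integral_add_adjacent_intervals
    (intervalIntegrable_of_integrableOn_Icc hi (a := 0) (by simp) ha)
    (intervalIntegrable_of_integrableOn_Icc hi ha hx)]
  ring

/-- Below the top, `g (j + 1)` is continuous on [0,1]. Extending it continuously to the line makes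
the fundamental theorem of calculus available at the end points too. -/
lemma derivWithin_eq (hg : IsPrimitiveChain m g) {j : ℕ} (hj : j + 1 < m) {x : ℝ}
    (hx : x ∈ Icc (0 : ℝ) 1) : HasDerivWithinAt (g j) (g (j + 1) x) (Icc (0 : ℝ) 1) x := by
  set h : ℝ → ℝ := IccExtend (zero_le_one : (0 : ℝ) ≤ 1) (fun t : Icc (0 : ℝ) 1 => g (j + 1) t)
  have hc : Continuous h := (continuousOn_iff_continuous_domRestrict.1 (hg.continuousOn hj)).Icc_extend'
  have heq : ∀ y ∈ Icc (0 : ℝ) 1, h y = g (j + 1) y := fun y hy => IccExtend_of_mem _ _ hy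
  have hd : HasDerivAt (fun y => g j 0 + ∫ t in (0 : ℝ)..y, h t) (h x) x :=
    (hc.integral_hasStrictDerivAt 0 x).hasDerivAt.const_add _
  rw [heq x hx] at hd
  refine hd.hasDerivWithinAt.congr_of_mem (fun y hy => ?_) hx
  rw [hg.ftc j (by omega) y hy]
  congr 1
  refine intervalIntegral.integral_congr fun t ht => ?_
  rw [uIcc_of_le hy.1] at ht
  exact (heq t ⟨ht.1, ht.2.trans hy.2⟩).symm

lemma D_eq (hg : IsPrimitiveChain m g) {f : I → ℝ} (hf : ∀ t : I, f t = g 0 t) :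
    ∀ j < m, ∀ x ∈ Icc (0 : ℝ) 1, D j f x = g j x := by
  intro j
  induction j with
  | zero => intro _ x hx; rw [← hf ⟨x, hx⟩, ← D_zero_apply f ⟨x, hx⟩]
  | succ j ih =>
    intro hj x hx
    rw [D_succ]
    have h := hg.derivWithin_eq hj hx
    rw [derivWithin_congr (fun y hy => ih (by omega) y hy) (ih (by omega) x hx)]
    exact h.derivWithin (uniqueDiffOn_Icc zero_lt_one x hx)

/-- The last term of a chain is merely integrable, so Lebesgue's differentiation theorem replaces
the fundamental theorem and the identity holds only almost everywhere. -/
lemma D_ae_eq (hm : 1 ≤ m) (hg : IsPrimitiveChain m g) {f : I → ℝ} (hf : ∀ t : I, f t = g 0 t) :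
    D m f =ᵐ[volume.restrict (Icc (0 : ℝ) 1)] g m := by
  obtain ⟨k, rfl⟩ : ∃ k, m = k + 1 := ⟨m - 1, by omega⟩
  have hi := intervalIntegrable_of_integrableOn_Icc (hg.integrableOn k (by omega))
    (a := 0) (b := 1) (by simp) (by simp)
  refine ae_restrict_Icc_of_Ioo ?_
  filter_upwards [hi.ae_hasDerivAt_integral] with x hx hx1
  have hx2 := hx (by rw [uIcc_of_le zero_le_one]; exact Ioo_subset_Icc_self hx1) 0 (by simp)
  have hD : ∀ y ∈ Icc (0 : ℝ) 1, D k f y = g k 0 + ∫ t in (0 : ℝ)..y, g (k + 1) t := fun y hy => by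
    rw [hg.D_eq hf k (by omega) y hy, hg.ftc k (by omega) y hy]
  rw [D_succ, derivWithin_congr hD (hD x (Ioo_subset_Icc_self hx1)), derivWithin_Icc_eq_deriv hx1]
  exact (hx2.const_add _).deriv

/-- Chains are stable under linear operations and limits, unlike iterated derivatives taken
directly. Membership of sums, polynomials and eigen-series in S^m is therefore always proved through
a chain. -/
lemma memSobolev (hm : 1 ≤ m) (hg : IsPrimitiveChain m g) {f : I → ℝ}
    (hf : ∀ t : I, f t = g 0 t) : MemSobolev m f := by
  refine ⟨?_, fun j hj => ?_, hg.memLp.ae_eq (hg.D_ae_eq hm hf).symm⟩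
  · have hc : Continuous f := by
      have := continuousOn_iff_continuous_domRestrict.1 (hg.continuousOn (j := 0) (by omega))
      exact this.congr fun t => (hf t).symm
    exact hc.memLp_of_hasCompactSupport (HasCompactSupport.of_compactSpace f)
  · have h := hg.absCont hj
    -- `D j f` and the primitive agree only on [0,1], so the ε-δ definition is unfolded: it
    -- evaluates them only at points of that interval.
    rw [absolutelyContinuousOnInterval_iff] at h ⊢
    intro ε hε
    obtain ⟨δ, hδ, h⟩ := h ε hε
    refine ⟨δ, hδ, fun E hE hlt => ?_⟩
    have := h E hE hlt
    refine lt_of_eq_of_lt (Finset.sum_congr rfl fun i hi => ?_) this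
    have hE' := hE.1 i hi
    rw [uIcc_of_le zero_le_one] at hE'
    rw [hg.D_eq hf j hj _ hE'.1, hg.D_eq hf j hj _ hE'.2, ← hg.ftc j hj _ hE'.1,
      ← hg.ftc j hj _ hE'.2]

lemma sum {ι : Type*} (s : Finset ι) (c : ι → ℝ) {g : ι → ℕ → ℝ → ℝ}
    (hg : ∀ i ∈ s, IsPrimitiveChain m (g i)) :
    IsPrimitiveChain m (fun j x => ∑ i ∈ s, c i * g i j x) := by
  refine ⟨fun j hj => ?_, ?_, fun j hj x hx => ?_⟩
  · exact integrable_finsetSum _ fun i hi => ((hg i hi).integrableOn j hj).const_mul _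
  · exact memLp_finsetSum _ fun i hi => (hg i hi).memLp.const_mul _
  · rw [intervalIntegral.integral_finsetSum, ← Finset.sum_add_distrib]
    · refine Finset.sum_congr rfl fun i hi => ?_
      rw [(hg i hi).ftc j hj x hx, intervalIntegral.integral_const_mul]
      ring
    · exact fun i hi => (intervalIntegrable_of_integrableOn_Icc ((hg i hi).integrableOn j hj)
        (by simp) hx).const_mul _

lemma sub (hg : IsPrimitiveChain m g) (hg' : IsPrimitiveChain m g') :
    IsPrimitiveChain m (fun j x => g j x - g' j x) := by
  refine ⟨fun j hj => (hg.integrableOn j hj).sub (hg'.integrableOn j hj),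
    hg.memLp.sub hg'.memLp, fun j hj x hx => ?_⟩
  rw [intervalIntegral.integral_sub, hg.ftc j hj x hx, hg'.ftc j hj x hx]
  · ring
  · exact intervalIntegrable_of_integrableOn_Icc (hg.integrableOn j hj) (by simp) hx
  · exact intervalIntegrable_of_integrableOn_Icc (hg'.integrableOn j hj) (by simp) hx

end IsPrimitiveChain

lemma MemSobolev.continuousOn_D {m : ℕ} {f : I → ℝ} (hf : MemSobolev m f) {j : ℕ} (hj : j < m) :
    ContinuousOn (D j f) (Icc (0 : ℝ) 1) :=
  hf.isPrimitiveChain.continuousOn hj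

lemma MemSobolev.continuous {m : ℕ} (hm : 1 ≤ m) {f : I → ℝ} (hf : MemSobolev m f) :
    Continuous f := by
  have := continuousOn_iff_continuous_domRestrict.1 (hf.continuousOn_D (j := 0) (by omega))
  exact this.congr fun t => D_zero_apply f t

lemma MemSobolev.sub {m : ℕ} (hm : 1 ≤ m) {f g : I → ℝ} (hf : MemSobolev m f)
    (hg : MemSobolev m g) : MemSobolev m (fun t => f t - g t) :=
  (hf.isPrimitiveChain.sub hg.isPrimitiveChain).memSobolev hm fun t => by simp [D_zero_apply]

lemma D_sub {m : ℕ} {f g : I → ℝ} (hf : MemSobolev m f) (hg : MemSobolev m g)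
    {j : ℕ} (hj : j < m) {x : ℝ} (hx : x ∈ Icc (0 : ℝ) 1) :
    D j (fun t => f t - g t) x = D j f x - D j g x :=
  (hf.isPrimitiveChain.sub hg.isPrimitiveChain).D_eq (fun t => by simp [D_zero_apply]) j hj x hx

lemma D_sub_ae {m : ℕ} (hm : 1 ≤ m) {f g : I → ℝ} (hf : MemSobolev m f) (hg : MemSobolev m g) :
    D m (fun t => f t - g t) =ᵐ[volume.restrict (Icc (0 : ℝ) 1)] fun x => D m f x - D m g x :=
  (hf.isPrimitiveChain.sub hg.isPrimitiveChain).D_ae_eq hm (fun t => by simp [D_zero_apply])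

section sum

variable {m : ℕ} {ι : Type*} {s : Finset ι} {f : ι → I → ℝ}

lemma MemSobolev.sum (hm : 1 ≤ m) (c : ι → ℝ) (hf : ∀ i ∈ s, MemSobolev m (f i)) :
    MemSobolev m (fun t => ∑ i ∈ s, c i * f i t) :=
  (IsPrimitiveChain.sum s c fun i hi => (hf i hi).isPrimitiveChain).memSobolev hm
    fun t => by simp [D_zero_apply]

lemma D_sum (c : ι → ℝ) (hf : ∀ i ∈ s, MemSobolev m (f i)) {j : ℕ} (hj : j < m) {x : ℝ}
    (hx : x ∈ Icc (0 : ℝ) 1) :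
    D j (fun t => ∑ i ∈ s, c i * f i t) x = ∑ i ∈ s, c i * D j (f i) x :=
  (IsPrimitiveChain.sum s c fun i hi => (hf i hi).isPrimitiveChain).D_eq
    (fun t => by simp [D_zero_apply]) j hj x hx

lemma D_sum_ae (hm : 1 ≤ m) (c : ι → ℝ) (hf : ∀ i ∈ s, MemSobolev m (f i)) :
    D m (fun t => ∑ i ∈ s, c i * f i t) =ᵐ[volume.restrict (Icc (0 : ℝ) 1)]
      fun x => ∑ i ∈ s, c i * D m (f i) x :=
  (IsPrimitiveChain.sum s c fun i hi => (hf i hi).isPrimitiveChain).D_ae_eq hm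
    (fun t => by simp [D_zero_apply])

end sum

open Polynomial in
/-- Polynomials belong to the Sobolev space, with the expected derivatives. -/
lemma isPrimitiveChain_polynomial (m : ℕ) (p : ℝ[X]) :
    IsPrimitiveChain m (fun j x => (derivative^[j] p).eval x) := by
  have hc : ∀ j, Continuous fun x : ℝ => (derivative^[j] p).eval x := fun j => Polynomial.continuous _
  refine ⟨fun j _ => (hc (j + 1)).continuousOn.integrableOn_Icc, ?_, fun j _ x _ => ?_⟩
  · obtain ⟨C, hC⟩ := isCompact_Icc.exists_bound_of_continuousOn (hc m).continuousOn (s := Icc (0 : ℝ) 1)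
    exact MemLp.of_bound (hc m).aestronglyMeasurable C
      ((ae_restrict_iff' measurableSet_Icc).2 (.of_forall hC))
  · rw [intervalIntegral.integral_eq_sub_of_hasDerivAt
      (f := fun x => (derivative^[j] p).eval x) (fun t _ => ?_) ((hc (j + 1)).intervalIntegrable _ _)]
    · ring
    · rw [Function.iterate_succ_apply']
      exact Polynomial.hasDerivAt _ _

end SplineBayes

/-! ### Tilting infinite products of Gaussian laws -/

namespace SplineBayes

open Filter Topology in
/-- If the one-dimensional densities `e i` change `μ i` into multiples of `κ i`, and the partial
products of the `e i` converge a.e. to a nonzero limit `E`, then `E` is, up to normalization, the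
density of the product of the `κ i` with respect to the product of the `μ i`. -/
lemma withDensity_infinitePi {X : Type*} [MeasurableSpace X] {μ κ : ℕ → Measure X}
    [∀ i, IsProbabilityMeasure (μ i)] [∀ i, IsProbabilityMeasure (κ i)]
    {e : ℕ → X → ℝ≥0∞} (he : ∀ i, Measurable (e i)) (he1 : ∀ i x, e i x ≤ 1) {z : ℕ → ℝ≥0∞}
    (hz : ∀ i, (μ i).withDensity (e i) = z i • κ i) {E : (ℕ → X) → ℝ≥0∞}
    (hE : ∀ᵐ x ∂(Measure.infinitePi μ),
      Tendsto (fun K => ∏ i ∈ Finset.range K, e i (x i)) atTop (𝓝 (E x)))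
    (hE0 : ∀ᵐ x ∂(Measure.infinitePi μ), E x ≠ 0) :
    ∫⁻ x, E x ∂(Measure.infinitePi μ) ≠ 0 ∧ ∫⁻ x, E x ∂(Measure.infinitePi μ) ≠ ⊤ ∧
    (Measure.infinitePi μ).withDensity E
      = (∫⁻ x, E x ∂(Measure.infinitePi μ)) • Measure.infinitePi κ := by
  classical
  set Q := Measure.infinitePi μ
  have hmeas : ∀ K, Measurable fun x : ℕ → X => ∏ i ∈ Finset.range K, e i (x i) := fun K =>
    Finset.measurable_prod _ fun i _ => (he i).comp (measurable_pi_apply i)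
  have hle : ∀ K (x : ℕ → X), ∏ i ∈ Finset.range K, e i (x i) ≤ 1 := fun K x =>
    Finset.prod_le_one' fun i _ => he1 i _
  have haem : AEMeasurable E Q := aemeasurable_of_tendsto_metrizable_ae atTop
    (fun K => (hmeas K).aemeasurable) hE
  have hne : ∫⁻ x, E x ∂Q ≠ 0 := by
    rw [Ne, lintegral_eq_zero_iff' haem]
    intro h
    have : ∀ᵐ _ ∂Q, False := by
      filter_upwards [h, hE0] with x h1 h2 using h2 h1
    simpa using this.exists
  have hEle : ∀ᵐ x ∂Q, E x ≤ 1 := by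
    filter_upwards [hE] with x hx using le_of_tendsto' hx fun K => hle K x
  have htop : ∫⁻ x, E x ∂Q ≠ ⊤ := by
    refine ne_top_of_le_ne_top ENNReal.one_ne_top ((lintegral_mono_ae hEle).trans ?_)
    simp
  refine ⟨hne, htop, ?_⟩
  -- On a box the indicator factors along the coordinates, so independence splits the integral, and
  -- each factor is `z i * κ i (T i)`.
  have hfin : ∀ (T : ℕ → Set X), (∀ i, MeasurableSet (T i)) → ∀ K,
      ∫⁻ x in Set.pi (Finset.range K) T, ∏ i ∈ Finset.range K, e i (x i) ∂Q
        = (∏ i ∈ Finset.range K, z i) * ∏ i ∈ Finset.range K, κ i (T i) := by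
    intro T hT K
    have hS : MeasurableSet (Set.pi (Finset.range K : Set ℕ) T) :=
      MeasurableSet.pi (Finset.countable_toSet _) fun i _ => hT i
    rw [← lintegral_indicator hS]
    have h1 : ∀ x : ℕ → X, (Set.pi (Finset.range K : Set ℕ) T).indicator
        (fun x => ∏ i ∈ Finset.range K, e i (x i)) x
        = ∏ i ∈ Finset.range K, (T i).indicator (e i) (x i) := by
      intro x
      by_cases hx : x ∈ Set.pi (Finset.range K : Set ℕ) T
      · rw [indicator_of_mem hx]
        exact Finset.prod_congr rfl fun i hi => (indicator_of_mem (hx i hi) _).symm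
      · rw [indicator_of_notMem hx]
        simp only [Set.mem_pi, not_forall] at hx
        obtain ⟨i, hi, hxi⟩ := hx
        exact (Finset.prod_eq_zero (Finset.mem_coe.1 hi) (indicator_of_notMem hxi _)).symm
    simp_rw [h1]
    have hX : ∀ i, Measurable ((T i).indicator (e i)) := fun i => (he i).indicator (hT i)
    rw [lintegral_prod_eq_prod_lintegral_of_indepFun _ _ (iIndepFun_infinitePi hX)
      (fun i => (hX i).comp (measurable_pi_apply i)), ← Finset.prod_mul_distrib]
    refine Finset.prod_congr rfl fun i _ => ?_
    have h2 : ∫⁻ x, (T i).indicator (e i) (x i) ∂Q = ∫⁻ y, (T i).indicator (e i) y ∂(μ i) := by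
      rw [← Measure.infinitePi_map_eval μ i, lintegral_map (hX i) (measurable_pi_apply i)]
    rw [h2, lintegral_indicator (hT i), ← withDensity_apply _ (hT i), hz i]
    simp
  have hlim : ∀ S : Set (ℕ → X), Tendsto (fun K => ∫⁻ x in S, ∏ i ∈ Finset.range K, e i (x i) ∂Q)
      atTop (𝓝 (∫⁻ x in S, E x ∂Q)) := fun S =>
    tendsto_lintegral_of_dominated_convergence (fun _ => 1) hmeas
      (fun K => .of_forall (hle K)) (by simp [measure_ne_top]) (ae_restrict_of_ae hE)
  have hZ : Tendsto (fun K => ∏ i ∈ Finset.range K, z i) atTop (𝓝 (∫⁻ x, E x ∂Q)) := by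
    have h := hlim univ
    rw [Measure.restrict_univ] at h
    refine h.congr fun K => ?_
    have := hfin (fun _ => univ) (fun _ => MeasurableSet.univ) K
    simpa using this
  have key : (∫⁻ x, E x ∂Q)⁻¹ • Q.withDensity E = Measure.infinitePi κ := by
    refine Measure.eq_infinitePi κ fun s t ht => ?_
    have hS : MeasurableSet (Set.pi (s : Set ℕ) t) :=
      MeasurableSet.pi (Finset.countable_toSet _) fun i _ => ht i
    rw [Measure.smul_apply, withDensity_apply _ hS, smul_eq_mul]
    have h1 : Tendsto (fun K => ∫⁻ x in Set.pi (s : Set ℕ) t, ∏ i ∈ Finset.range K, e i (x i) ∂Q)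
        atTop (𝓝 ((∫⁻ x, E x ∂Q) * ∏ i ∈ s, κ i (t i))) := by
      refine Tendsto.congr' ?_ (ENNReal.Tendsto.mul_const hZ (Or.inl hne))
      obtain ⟨N, hN⟩ := s.exists_nat_subset_range
      filter_upwards [eventually_ge_atTop N] with K hK
      have hsub : s ⊆ Finset.range K := hN.trans (Finset.range_mono hK)
      -- The box over `s` is padded with `univ` up to `range K`; the extra factors `κ i univ` equal
      -- 1, while the product of all `z i`, `i < K`, tends to the total mass.
      have h2 := hfin (fun i => if i ∈ s then t i else univ)
        (fun i => by split_ifs; exacts [ht i, MeasurableSet.univ]) K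
      have h3 : Set.pi (Finset.range K : Set ℕ) (fun i => if i ∈ s then t i else univ)
          = Set.pi (s : Set ℕ) t := by
        ext x
        simp only [Set.mem_pi]
        refine ⟨fun h i hi => ?_, fun h i _ => ?_⟩
        · have := h i (hsub hi)
          rwa [if_pos (Finset.mem_coe.1 hi)] at this
        · split_ifs with his
          exacts [h i his, mem_univ _]
      rw [h3] at h2
      rw [h2]
      congr 1
      rw [← Finset.prod_subset hsub (fun i _ hi => by simp [hi])]
      exact Finset.prod_congr rfl fun i hi => by rw [if_pos hi]
    rw [tendsto_nhds_unique (hlim _) h1, ← mul_assoc, ENNReal.inv_mul_cancel hne htop, one_mul]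
  rw [← key, smul_smul, ENNReal.mul_inv_cancel hne htop, one_smul]

/-- A Gaussian prior and a Gaussian likelihood give a Gaussian posterior. -/
lemma gaussianReal_withDensity_exp {t c : ℝ} (ht : 0 < t) (hc : 0 < c) (f : ℝ) :
    ∃ z : ℝ≥0∞, (gaussianReal 0 (Real.toNNReal t⁻¹)).withDensity
        (fun x => ENNReal.ofReal (Real.exp (-(1 / 2) * (c * (x - f) ^ 2))))
      = z • gaussianReal (c / (t + c) * f) (Real.toNNReal (t + c)⁻¹) := by
  have htc : 0 < t + c := by positivity
  have h1 : Real.toNNReal t⁻¹ ≠ 0 := by simp [ht]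
  have h2 : Real.toNNReal (t + c)⁻¹ ≠ 0 := by simp [htc]
  have hπ := Real.pi_pos
  -- From t x² + c (x - f)² = (t + c)(x - c f/(t + c))² + (t c/(t + c)) f²: the constant is the
  -- quotient of the two normalizations times the exponential of the remainder.
  refine ⟨ENNReal.ofReal ((√(2 * Real.pi * t⁻¹))⁻¹ * √(2 * Real.pi * (t + c)⁻¹)
    * Real.exp (-(1 / 2) * (t * c / (t + c) * f ^ 2))), ?_⟩
  rw [gaussianReal_of_var_ne_zero _ h1, gaussianReal_of_var_ne_zero _ h2,
    ← withDensity_mul _ (measurable_gaussianPDF _ _) (by fun_prop),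
    ← withDensity_smul _ (measurable_gaussianPDF _ _)]
  congr 1
  funext x
  simp only [Pi.mul_apply, Pi.smul_apply, smul_eq_mul, gaussianPDF]
  rw [← ENNReal.ofReal_mul (gaussianPDFReal_nonneg _ _ _), ← ENNReal.ofReal_mul (by positivity)]
  congr 1
  simp only [gaussianPDFReal, Real.coe_toNNReal _ (inv_nonneg.2 ht.le),
    Real.coe_toNNReal _ (inv_nonneg.2 htc.le)]
  have h3 : √(2 * Real.pi * (t + c)⁻¹) ≠ 0 := by positivity
  have h4 : √(2 * Real.pi * t⁻¹) ≠ 0 := by positivity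
  field_simp
  rw [← Real.exp_add, ← Real.exp_add]
  congr 1
  field_simp
  ring

/-- For nonnegative terms, summability is finiteness of the extended sum, which is a measurable
function. -/
lemma measurableSet_summable_nonneg {α : Type*} [MeasurableSpace α] {g : ℕ → α → ℝ}
    (hg : ∀ ν, Measurable (g ν)) (h0 : ∀ ν a, 0 ≤ g ν a) :
    MeasurableSet {a | Summable fun ν => g ν a} := by
  have : {a | Summable fun ν => g ν a} = {a | ∑' ν, ENNReal.ofReal (g ν a) ≠ ⊤} := by
    ext a
    refine ⟨fun h => h.tsum_ofReal_ne_top, fun h => ?_⟩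
    exact (ENNReal.summable_toReal h).congr fun ν => by rw [ENNReal.toReal_ofReal (h0 ν a)]
  rw [this]
  exact (measurableSet_singleton ⊤).compl.preimage (Measurable.tsum fun ν => (hg ν).ennreal_ofReal)

open Filter Topology in
/-- The law of independent Gaussian variables tilted by `exp (-½ ∑ c_ν (x_ν - f_ν)²)` is the law of
an affine transformation of the variables. -/
lemma withDensity_map_gaussian {Ω : Type*} [MeasurableSpace Ω] {P : Measure Ω}
    [IsProbabilityMeasure P] {v : ℕ → Ω → ℝ} (hv : ∀ ν, Measurable (v ν)) (hindep : iIndepFun v P)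
    {t c f : ℕ → ℝ} (ht : ∀ ν, 0 < t ν) (hc : ∀ ν, 0 < c ν)
    (hlaw : ∀ ν, P.map (v ν) = gaussianReal 0 (Real.toNNReal (t ν)⁻¹))
    (hs : ∀ᵐ ω ∂P, Summable fun ν => c ν * (v ν ω - f ν) ^ 2) :
    ∃ Z : ℝ≥0∞, Z ≠ 0 ∧ Z ≠ ⊤ ∧
      (P.map fun ω ν => v ν ω).withDensity
          (fun x => ENNReal.ofReal (Real.exp (-(1 / 2) * ∑' ν, c ν * (x ν - f ν) ^ 2)))
        = Z • P.map (fun ω ν => c ν / (t ν + c ν) * f ν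
            + (√(t ν + c ν))⁻¹ * √(t ν) * v ν ω) := by
  have hV : P.map (fun ω ν => v ν ω)
      = Measure.infinitePi fun ν => gaussianReal 0 (Real.toNNReal (t ν)⁻¹) := by
    rw [hindep.map_fun_eq_infinitePi_map hv]
    simp_rw [hlaw]
  have hvm : Measurable fun ω ν => v ν ω := measurable_pi_lambda _ hv
  -- An affine map of each coordinate keeps the product form; the new variance is (t/(t + c)) · t⁻¹
  -- = (t + c)⁻¹, that of the one-dimensional posterior.
  have hW : P.map (fun ω ν => c ν / (t ν + c ν) * f ν + (√(t ν + c ν))⁻¹ * √(t ν) * v ν ω)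
      = Measure.infinitePi fun ν =>
        gaussianReal (c ν / (t ν + c ν) * f ν) (Real.toNNReal (t ν + c ν)⁻¹) := by
    have ha : ∀ ν, Measurable fun x : ℝ =>
        c ν / (t ν + c ν) * f ν + (√(t ν + c ν))⁻¹ * √(t ν) * x := fun ν => by fun_prop
    have hb := Measure.infinitePi_map_pi
      (μ := fun ν => gaussianReal 0 (Real.toNNReal (t ν)⁻¹)) ha
    have hcm : Measurable fun (x : ℕ → ℝ) i =>
        c i / (t i + c i) * f i + (√(t i + c i))⁻¹ * √(t i) * x i :=
      measurable_pi_lambda _ fun ν => (ha ν).comp (measurable_pi_apply ν)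
    rw [← hV, Measure.map_map hcm hvm] at hb
    rw [show (fun ω ν => c ν / (t ν + c ν) * f ν + (√(t ν + c ν))⁻¹ * √(t ν) * v ν ω)
      = (fun (x : ℕ → ℝ) i => c i / (t i + c i) * f i + (√(t i + c i))⁻¹ * √(t i) * x i)
        ∘ fun ω ν => v ν ω from rfl, hb]
    congr 1
    funext ν
    have htc : 0 < t ν + c ν := add_pos (ht ν) (hc ν)
    rw [show (fun x : ℝ => c ν / (t ν + c ν) * f ν + (√(t ν + c ν))⁻¹ * √(t ν) * x)
      = (fun y => c ν / (t ν + c ν) * f ν + y) ∘ fun x => (√(t ν + c ν))⁻¹ * √(t ν) * x from rfl,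
      ← Measure.map_map (by fun_prop) (by fun_prop), gaussianReal_map_const_mul,
      gaussianReal_map_const_add, mul_zero, zero_add]
    congr 1
    apply NNReal.coe_injective
    push_cast
    rw [Real.coe_toNNReal _ (inv_nonneg.2 (ht ν).le), Real.coe_toNNReal _ (inv_nonneg.2 htc.le)]
    rw [mul_pow, inv_pow, Real.sq_sqrt htc.le, Real.sq_sqrt (ht ν).le]
    have := (ht ν).ne'
    field_simp
  choose z hz using fun ν => gaussianReal_withDensity_exp (ht ν) (hc ν) (f ν)
  have hlim : ∀ᵐ x ∂(P.map fun ω ν => v ν ω),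
      Tendsto (fun K => ∏ i ∈ Finset.range K,
        ENNReal.ofReal (Real.exp (-(1 / 2) * (c i * (x i - f i) ^ 2)))) atTop
        (𝓝 (ENNReal.ofReal (Real.exp (-(1 / 2) * ∑' ν, c ν * (x ν - f ν) ^ 2)))) := by
    have hms : MeasurableSet {x : ℕ → ℝ | Summable fun ν => c ν * (x ν - f ν) ^ 2} :=
      measurableSet_summable_nonneg (fun ν => by fun_prop)
        fun ν x => mul_nonneg (hc ν).le (sq_nonneg _)
    filter_upwards [(ae_map_iff hvm.aemeasurable hms).2 hs] with x hx
    have h1 : ∀ K, ∏ i ∈ Finset.range K,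
        ENNReal.ofReal (Real.exp (-(1 / 2) * (c i * (x i - f i) ^ 2)))
        = ENNReal.ofReal (Real.exp (-(1 / 2) * ∑ i ∈ Finset.range K,
          c i * (x i - f i) ^ 2)) := fun K => by
      rw [Finset.mul_sum, Real.exp_sum, ENNReal.ofReal_prod_of_nonneg fun i _ => (Real.exp_pos _).le]
    simp_rw [h1]
    exact (ENNReal.continuous_ofReal.comp (Real.continuous_exp.comp
      (continuous_const.mul continuous_id))).continuousAt.tendsto.comp hx.hasSum.tendsto_sum_nat
  rw [hV] at hlim ⊢
  rw [hW]
  obtain ⟨h0, h1, h2⟩ := withDensity_infinitePi (fun i => by fun_prop)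
    (fun i x => ENNReal.ofReal_le_one.2 (Real.exp_le_one_iff.2 (by
      have := mul_nonneg (hc i).le (sq_nonneg (x - f i)); linarith))) hz hlim
    (.of_forall fun x => by simp [Real.exp_pos])
  exact ⟨_, h0, h1, h2⟩

end SplineBayes

/-! ### Cauchy–Schwarz and Poincaré inequalities -/

namespace SplineBayes

section CauchySchwarz

/-- Expanding ∫ (L g - s)² ≥ 0, with `L` the total mass and `s` the integral, gives L (L ∫ g² - s²)
≥ 0; a zero measure is treated apart. -/
lemma sq_integral_le {α : Type*} [MeasurableSpace α] {μ : Measure α} [IsFiniteMeasure μ]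
    {g : α → ℝ} (hg : MemLp g 2 μ) : (∫ x, g x ∂μ) ^ 2 ≤ μ.real univ * ∫ x, g x ^ 2 ∂μ := by
  set L := μ.real univ
  set s := ∫ x, g x ∂μ
  have hL : 0 ≤ L := measureReal_nonneg
  have h1 : Integrable g μ := hg.integrable (by norm_num)
  have h2 : Integrable (fun x => g x ^ 2) μ := hg.integrable_sq
  have h0 : 0 ≤ ∫ x, (L * g x - s) ^ 2 ∂μ := integral_nonneg fun x => sq_nonneg _
  have h3 : ∫ x, (L * g x - s) ^ 2 ∂μ = L ^ 2 * ∫ x, g x ^ 2 ∂μ - 2 * L * s * s + s ^ 2 * L := by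
    have : ∀ x, (L * g x - s) ^ 2 = L ^ 2 * g x ^ 2 - 2 * L * s * g x + s ^ 2 := fun x => by ring
    simp_rw [this]
    rw [integral_add, integral_sub, integral_const_mul, integral_const_mul, integral_const,
      smul_eq_mul]
    · ring
    · exact h2.const_mul _
    · exact h1.const_mul _
    · exact (h2.const_mul _).sub (h1.const_mul _)
    · exact integrable_const _
  rw [h3] at h0
  rcases hL.eq_or_lt with h | h
  · have hμ : μ = 0 := by
      have : μ.real univ = 0 := h.symm
      rwa [measureReal_eq_zero_iff, Measure.measure_univ_eq_zero] at this
    have : s = 0 := by simp [s, hμ]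
    rw [this, ← h]; simp
  · have : 0 ≤ L * (L * ∫ x, g x ^ 2 ∂μ - s ^ 2) := by nlinarith
    have := nonneg_of_mul_nonneg_right this h
    linarith

lemma sq_intervalIntegral_le {g : ℝ → ℝ} (hg : MemLp g 2 (volume.restrict (Icc (0 : ℝ) 1)))
    {a x b : ℝ} (ha : 0 ≤ a) (hax : a ≤ x) (hxb : x ≤ b) (hb : b ≤ 1) :
    (∫ t in a..x, g t) ^ 2 ≤ (b - a) * ∫ t in a..b, g t ^ 2 := by
  have hg1 : MemLp g 2 (volume.restrict (Ioc a b)) := hg.mono_measure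
    (Measure.restrict_mono (Ioc_subset_Icc_self.trans (Icc_subset_Icc ha hb)) le_rfl)
  have hg2 : MemLp g 2 (volume.restrict (Ioc a x)) := hg1.mono_measure
    (Measure.restrict_mono (Ioc_subset_Ioc le_rfl hxb) le_rfl)
  have h := sq_integral_le hg2
  rw [intervalIntegral.integral_of_le hax, intervalIntegral.integral_of_le (hax.trans hxb)]
  refine h.trans ?_
  have h1 : (volume.restrict (Ioc a x)).real univ = x - a := by simp [hax]
  rw [h1]
  have h2 : ∫ t in Ioc a x, g t ^ 2 ≤ ∫ t in Ioc a b, g t ^ 2 :=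
    setIntegral_mono_set hg1.integrable_sq (.of_forall fun t => sq_nonneg _)
      (Ioc_subset_Ioc le_rfl hxb).eventuallyLE
  have h3 : 0 ≤ ∫ t in Ioc a x, g t ^ 2 := integral_nonneg fun t => sq_nonneg _
  exact mul_le_mul (by linarith) h2 h3 (by linarith)

end CauchySchwarz

namespace IsPrimitiveChain

variable {m : ℕ} {g : ℕ → ℝ → ℝ}

lemma memLp' (hg : IsPrimitiveChain m g) {j : ℕ} (hj : j ≤ m) :
    MemLp (g j) 2 (volume.restrict (Icc (0 : ℝ) 1)) := by
  rcases hj.eq_or_lt with rfl | hj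
  · exact hg.memLp
  · have hc := hg.continuousOn hj
    obtain ⟨C, hC⟩ := isCompact_Icc.exists_bound_of_continuousOn hc
    exact MemLp.of_bound (hc.aestronglyMeasurable measurableSet_Icc) C
      ((ae_restrict_iff' measurableSet_Icc).2 (.of_forall hC))

lemma intervalIntegrable_sq (hg : IsPrimitiveChain m g) {j : ℕ} (hj : j ≤ m) {a b : ℝ}
    (ha : a ∈ Icc (0 : ℝ) 1) (hb : b ∈ Icc (0 : ℝ) 1) :
    IntervalIntegrable (fun x => g j x ^ 2) volume a b :=
  intervalIntegrable_of_integrableOn_Icc (hg.memLp' hj).integrable_sq ha hb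

/-- A chain vanishing at the left end of an interval of length `b - a` satisfies a Poincaré
inequality there. -/
lemma integral_sq_le (hg : IsPrimitiveChain m g) {a b : ℝ} (ha : 0 ≤ a) (hab : a ≤ b) (hb : b ≤ 1)
    (h0 : ∀ j < m, g j a = 0) :
    ∫ x in a..b, g 0 x ^ 2 ≤ (b - a) ^ (2 * m) * ∫ x in a..b, g m x ^ 2 := by
  have step : ∀ j < m, ∫ x in a..b, g j x ^ 2 ≤ (b - a) ^ 2 * ∫ x in a..b, g (j + 1) x ^ 2 := by
    intro j hj
    have h1 : ∫ x in a..b, g j x ^ 2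
        ≤ ∫ _ in a..b, (b - a) * ∫ x in a..b, g (j + 1) x ^ 2 := by
      refine intervalIntegral.integral_mono_on hab
        (hg.intervalIntegrable_sq hj.le ⟨ha, hab.trans hb⟩ ⟨ha.trans hab, hb⟩) (by simp) ?_
      intro x hx
      rw [hg.ftc' hj ⟨ha, hab.trans hb⟩ ⟨ha.trans hx.1, hx.2.trans hb⟩, h0 j hj, zero_add]
      exact sq_intervalIntegral_le (hg.memLp' hj) ha hx.1 hx.2 hb
    refine h1.trans (le_of_eq ?_)
    rw [intervalIntegral.integral_const, smul_eq_mul]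
    ring
  have : ∀ j ≤ m, ∫ x in a..b, g 0 x ^ 2 ≤ (b - a) ^ (2 * j) * ∫ x in a..b, g j x ^ 2 := by
    intro j
    induction j with
    | zero => simp
    | succ j ih =>
      intro hj
      refine (ih (by omega)).trans ?_
      rw [show 2 * (j + 1) = 2 * j + 2 by ring, pow_add, mul_assoc]
      exact mul_le_mul_of_nonneg_left (step j hj) (pow_nonneg (by linarith) _)
  exact this m le_rfl

/-- The Poincaré inequality is used on each cell of length 1/N, where the chain vanishes at the left
end. The gain N^(-2m) is the source of the eigenvalue growth. -/
lemma integral_sq_le_of_grid (hg : IsPrimitiveChain m g) {N : ℕ} (hN : 1 ≤ N)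
    (h0 : ∀ j < m, ∀ i < N, g j ((i : ℝ) / N) = 0) :
    ∫ x in (0 : ℝ)..1, g 0 x ^ 2 ≤ ((N : ℝ) ^ (2 * m))⁻¹ * ∫ x in (0 : ℝ)..1, g m x ^ 2 := by
  have hN0 : (0 : ℝ) < N := by exact_mod_cast hN
  have hmem : ∀ i ≤ N, (i : ℝ) / N ∈ Icc (0 : ℝ) 1 := fun i hi =>
    ⟨by positivity, (div_le_one hN0).2 (by exact_mod_cast hi)⟩
  have hsum : ∀ j ≤ m, ∫ x in (0 : ℝ)..1, g j x ^ 2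
      = ∑ i ∈ Finset.range N, ∫ x in ((i : ℝ) / N)..((i + 1 : ℕ) : ℝ) / N, g j x ^ 2 := by
    intro j hj
    have h1 := intervalIntegral.sum_integral_adjacent_intervals (μ := volume) (n := N)
      (a := fun i : ℕ => (i : ℝ) / N) (f := fun x => g j x ^ 2)
      (fun i hi => hg.intervalIntegrable_sq hj (hmem i hi.le) (hmem (i + 1) hi))
    rw [h1]
    simp [div_self hN0.ne']
  rw [hsum 0 (Nat.zero_le _), hsum m le_rfl, Finset.mul_sum]
  refine Finset.sum_le_sum fun i hi => ?_
  have hi' := Finset.mem_range.1 hi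
  have h2 := hg.integral_sq_le (hmem i hi'.le).1
    (b := ((i + 1 : ℕ) : ℝ) / N) (by gcongr; simp) (hmem (i + 1) hi').2 (fun j hj => h0 j hj i hi')
  have h3 : ((i + 1 : ℕ) : ℝ) / N - (i : ℝ) / N = (N : ℝ)⁻¹ := by
    push_cast; field_simp; ring
  rwa [h3, inv_pow] at h2

/-- A chain vanishing at `0` is bounded by the `L²` norm of its last term. -/
lemma sq_le (hg : IsPrimitiveChain m g) (h0 : ∀ j < m, g j 0 = 0) {j : ℕ} (hj : j < m) {x : ℝ}
    (hx : x ∈ Icc (0 : ℝ) 1) : g j x ^ 2 ≤ ∫ t in (0 : ℝ)..1, g m t ^ 2 := by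
  have step : ∀ j < m, ∀ x ∈ Icc (0 : ℝ) 1, g j x ^ 2 ≤ ∫ t in (0 : ℝ)..1, g (j + 1) t ^ 2 := by
    intro j hj x hx
    rw [hg.ftc j hj x hx, h0 j hj, zero_add]
    simpa using sq_intervalIntegral_le (hg.memLp' (j := j + 1) hj) le_rfl hx.1 hx.2 le_rfl
  have key : ∀ k, ∀ j < m, j + k + 1 = m → ∀ x ∈ Icc (0 : ℝ) 1,
      g j x ^ 2 ≤ ∫ t in (0 : ℝ)..1, g m t ^ 2 := by
    intro k
    induction k with
    | zero => intro j hj hjk x hx; have := step j hj x hx; rwa [show j + 1 = m by omega] at this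
    | succ k ih =>
      intro j hj hjk x hx
      refine (step j hj x hx).trans ?_
      have h1 : ∫ t in (0 : ℝ)..1, g (j + 1) t ^ 2
          ≤ ∫ _ in (0 : ℝ)..1, ∫ t in (0 : ℝ)..1, g m t ^ 2 :=
        intervalIntegral.integral_mono_on zero_le_one
          (hg.intervalIntegrable_sq hj (by simp) (by simp)) (by simp)
          fun y hy => ih (j + 1) (by omega) (by omega) y hy
      simpa using h1
  exact key (m - j - 1) j hj (by omega) x hx

end IsPrimitiveChain

lemma integral_unitInterval (g : ℝ → ℝ) : ∫ x : I, g x = ∫ x in (0 : ℝ)..1, g x := by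
  rw [intervalIntegral.integral_of_le zero_le_one, ← integral_Icc_eq_integral_Ioc]
  exact integral_subtype_comap measurableSet_Icc g

/-! ### The bilinear forms V and U -/

section Forms

variable {m : ℕ}

/-- The weight in the form `V`. -/
noncomputable def Model.weight (M : Model m) (x : I) : ℝ := deriv (deriv M.A) (M.f₀ x) * M.dens x

variable (M : Model m)

lemma Model.V_eq (f g : I → ℝ) : M.V f g = ∫ x, M.weight x * (f x * g x) := by
  unfold Model.V Model.weight
  exact integral_congr_ae (.of_forall fun x => by ring)

lemma Model.weight_bounds (hm : 1 ≤ m) : Measurable M.weight ∧ (∀ x, 0 ≤ M.weight x) ∧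
    ∃ C, 0 < C ∧ ∀ x, M.weight x ≤ C := by
  have hA : Continuous (deriv (deriv M.A)) := by
    have h := M.contDiff_A.continuous_iteratedDeriv 2 (by norm_num)
    simpa [iteratedDeriv_succ, iteratedDeriv_zero] using h
  have hc : Continuous fun x => deriv (deriv M.A) (M.f₀ x) :=
    hA.comp (M.mem_f₀.continuous hm)
  obtain ⟨c, hc0, hcl⟩ := M.dens_lower
  obtain ⟨C, hCu⟩ := M.dens_upper
  obtain ⟨B, hB⟩ := isCompact_univ.exists_bound_of_continuousOn hc.continuousOn
  have hpos : ∀ x, 0 < M.dens x := fun x => hc0.trans_le (hcl x)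
  refine ⟨hc.measurable.mul M.measurable_dens, fun x =>
    mul_nonneg (M.deriv2_A_pos _).le (hpos x).le, (|B| + 1) * (|C| + 1), by positivity, fun x => ?_⟩
  refine mul_le_mul ?_ ?_ (hpos x).le (by positivity)
  · have h1 := (le_abs_self _).trans (hB x (mem_univ x))
    linarith [le_abs_self B]
  · linarith [hCu x, le_abs_self C]

variable {M}

lemma integrable_V (hm : 1 ≤ m) {f g : I → ℝ} (hf : Continuous f) (hg : Continuous g) :
    Integrable fun x => M.weight x * (f x * g x) := by
  obtain ⟨hw, h0, C, -, hC⟩ := M.weight_bounds hm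
  have hfg : Integrable (fun x => f x * g x) :=
    (hf.mul hg).integrable_of_hasCompactSupport (HasCompactSupport.of_compactSpace _)
  exact hfg.bdd_mul hw.aestronglyMeasurable
    (.of_forall fun x => by rw [Real.norm_of_nonneg (h0 x)]; exact hC x)

lemma Model.V_comm (f g : I → ℝ) : M.V f g = M.V g f := by
  simp only [Model.V_eq, mul_comm (f _)]

lemma Model.V_self_nonneg (hm : 1 ≤ m) (f : I → ℝ) : 0 ≤ M.V f f := by
  rw [Model.V_eq]
  exact integral_nonneg fun x => mul_nonneg ((M.weight_bounds hm).2.1 x) (mul_self_nonneg _)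

lemma Model.V_sub_left (hm : 1 ≤ m) {f g q : I → ℝ} (hf : Continuous f) (hg : Continuous g)
    (hq : Continuous q) : M.V (fun t => f t - g t) q = M.V f q - M.V g q := by
  simp only [Model.V_eq]
  rw [← integral_sub (integrable_V hm hf hq) (integrable_V hm hg hq)]
  exact integral_congr_ae (.of_forall fun x => by ring)

lemma Model.V_sub_self (hm : 1 ≤ m) {f g : I → ℝ} (hf : Continuous f) (hg : Continuous g) :
    M.V (fun t => f t - g t) (fun t => f t - g t) = M.V f f - 2 * M.V f g + M.V g g := by
  rw [Model.V_sub_left hm hf hg (q := fun t => f t - g t) (hf.sub hg), Model.V_comm f, Model.V_comm g,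
    Model.V_sub_left hm hf hg hf, Model.V_sub_left hm hf hg hg, Model.V_comm g f]
  ring

lemma Model.V_sum_left (hm : 1 ≤ m) {ι : Type*} (s : Finset ι) (c : ι → ℝ) {f : ι → I → ℝ}
    {q : I → ℝ} (hf : ∀ i ∈ s, Continuous (f i)) (hq : Continuous q) :
    M.V (fun t => ∑ i ∈ s, c i * f i t) q = ∑ i ∈ s, c i * M.V (f i) q := by
  simp only [Model.V_eq, ← integral_const_mul]
  rw [← integral_finsetSum _ fun i hi => (integrable_V hm (hf i hi) hq).const_mul _]
  refine integral_congr_ae (.of_forall fun x => ?_)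
  simp only [Finset.sum_mul, Finset.mul_sum]
  exact Finset.sum_congr rfl fun i _ => by ring

lemma Model.V_self_le (hm : 1 ≤ m) : ∃ C, 0 < C ∧ ∀ f : I → ℝ, Continuous f →
    M.V f f ≤ C * ∫ x : I, f x ^ 2 := by
  obtain ⟨hw, h0, C, hC0, hC⟩ := M.weight_bounds hm
  refine ⟨C, hC0, fun f hf => ?_⟩
  rw [Model.V_eq, ← integral_const_mul]
  have hi : Integrable (fun x : I => f x ^ 2) :=
    (hf.pow 2).integrable_of_hasCompactSupport (HasCompactSupport.of_compactSpace _)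
  refine integral_mono (integrable_V hm hf hf) (hi.const_mul C) fun x => ?_
  simp only [← sq]
  exact mul_le_mul_of_nonneg_right (hC x) (sq_nonneg _)

lemma integrable_U {f g : I → ℝ} (hf : MemSobolev m f) (hg : MemSobolev m g) :
    Integrable (fun x => D m f x * D m g x) (volume.restrict (Icc (0 : ℝ) 1)) :=
  hf.memLp_deriv.integrable_mul hg.memLp_deriv

lemma U_comm (f g : I → ℝ) : U m f g = U m g f := by
  simp only [U, mul_comm]

lemma U_self_nonneg (f : I → ℝ) : 0 ≤ U m f f := integral_nonneg fun _ => mul_self_nonneg _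

lemma U_self_eq (f : I → ℝ) : U m f f = ∫ x in (0 : ℝ)..1, D m f x ^ 2 := by
  rw [intervalIntegral.integral_of_le zero_le_one, ← integral_Icc_eq_integral_Ioc]
  simp only [U, sq]

lemma U_sub_left (hm : 1 ≤ m) {f g q : I → ℝ} (hf : MemSobolev m f) (hg : MemSobolev m g)
    (hq : MemSobolev m q) : U m (fun t => f t - g t) q = U m f q - U m g q := by
  unfold U
  rw [← integral_sub (integrable_U hf hq) (integrable_U hg hq)]
  refine integral_congr_ae ?_
  filter_upwards [D_sub_ae hm hf hg] with x hx
  rw [hx]; ring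

lemma U_sub_self (hm : 1 ≤ m) {f g : I → ℝ} (hf : MemSobolev m f) (hg : MemSobolev m g) :
    U m (fun t => f t - g t) (fun t => f t - g t) = U m f f - 2 * U m f g + U m g g := by
  rw [U_sub_left hm hf hg (hf.sub hm hg), U_comm f, U_comm g,
    U_sub_left hm hf hg hf, U_sub_left hm hf hg hg, U_comm g f]
  ring

lemma U_sum_left (hm : 1 ≤ m) {ι : Type*} (s : Finset ι) (c : ι → ℝ) {f : ι → I → ℝ}
    {q : I → ℝ} (hf : ∀ i ∈ s, MemSobolev m (f i)) (hq : MemSobolev m q) :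
    U m (fun t => ∑ i ∈ s, c i * f i t) q = ∑ i ∈ s, c i * U m (f i) q := by
  simp only [U, ← integral_const_mul]
  rw [← integral_finsetSum _ fun i hi => (integrable_U (hf i hi) hq).const_mul _]
  refine integral_congr_ae ?_
  filter_upwards [D_sum_ae hm c hf] with x hx
  rw [hx, Finset.sum_mul]
  exact Finset.sum_congr rfl fun i _ => by ring

/-- A vanishing ∫ (q^(m))² forces q^(m) = 0 almost everywhere. Hence null functions of `U` are
eigenfunctions for the eigenvalue 0. -/
lemma U_eq_zero {q h : I → ℝ} (hq : MemSobolev m q) (hq0 : U m q q = 0) : U m q h = 0 := by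
  unfold U at hq0 ⊢
  rw [integral_eq_zero_iff_of_nonneg (fun x => mul_self_nonneg _) (integrable_U hq hq)] at hq0
  refine integral_eq_zero_of_ae ?_
  filter_upwards [hq0] with x hx
  simp only [Pi.zero_apply, mul_self_eq_zero] at hx ⊢
  rw [hx, zero_mul]

end Forms

end SplineBayes

/-! ### The eigen-system: growth, null space and Sobolev inequality -/

namespace SplineBayes

variable {m : ℕ} {M : Model m}

open Polynomial in
lemma memSobolev_polynomial (hm : 1 ≤ m) (p : ℝ[X]) : MemSobolev m (fun t : I => p.eval (t : ℝ)) :=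
  (isPrimitiveChain_polynomial m p).memSobolev hm fun _ => rfl

open Polynomial in
lemma U_polynomial_eq_zero (hm : 1 ≤ m) {p : ℝ[X]} (hp : p.natDegree < m) :
    U m (fun t : I => p.eval (t : ℝ)) (fun t : I => p.eval (t : ℝ)) = 0 := by
  have h := (isPrimitiveChain_polynomial m p).D_ae_eq hm
    (f := fun t : I => p.eval (t : ℝ)) fun _ => rfl
  refine integral_eq_zero_of_ae ?_
  filter_upwards [h] with x hx
  rw [hx, iterate_derivative_eq_zero hp]
  simp

namespace Model.IsEigenSystem

variable {φ : ℕ → I → ℝ} {ρ : ℕ → ℝ}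

lemma mem (hφ : M.IsEigenSystem φ ρ) (ν : ℕ) : MemSobolev m (φ ν) := (hφ.isEigen ν).1

lemma rho_nonneg (hφ : M.IsEigenSystem φ ρ) (ν : ℕ) : 0 ≤ ρ ν := by
  have h := (hφ.isEigen ν).2 (φ ν) (hφ.mem ν)
  rw [hφ.orthonormal, if_pos rfl, mul_one] at h
  rw [← h]
  exact U_self_nonneg _

lemma memSobolev_sum (hm : 1 ≤ m) (hφ : M.IsEigenSystem φ ρ) (s : Finset ℕ) (x : ℕ → ℝ) :
    MemSobolev m (fun t => ∑ ν ∈ s, x ν * φ ν t) :=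
  MemSobolev.sum hm x fun ν _ => hφ.mem ν

lemma V_sum (hm : 1 ≤ m) (hφ : M.IsEigenSystem φ ρ) (s : Finset ℕ) (x : ℕ → ℝ) {q : I → ℝ}
    (hq : Continuous q) :
    M.V (fun t => ∑ ν ∈ s, x ν * φ ν t) q = ∑ ν ∈ s, x ν * M.V (φ ν) q :=
  Model.V_sum_left hm s x (fun ν _ => (hφ.mem ν).continuous hm) hq

lemma V_sum_eigen (hm : 1 ≤ m) (hφ : M.IsEigenSystem φ ρ) (s : Finset ℕ) (x : ℕ → ℝ) (μ : ℕ) :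
    M.V (fun t => ∑ ν ∈ s, x ν * φ ν t) (φ μ) = if μ ∈ s then x μ else 0 := by
  rw [hφ.V_sum hm s x ((hφ.mem μ).continuous hm)]
  simp [hφ.orthonormal]

lemma V_sum_self (hm : 1 ≤ m) (hφ : M.IsEigenSystem φ ρ) (s : Finset ℕ) (x : ℕ → ℝ) :
    M.V (fun t => ∑ ν ∈ s, x ν * φ ν t) (fun t => ∑ ν ∈ s, x ν * φ ν t) = ∑ ν ∈ s, x ν ^ 2 := by
  rw [hφ.V_sum hm s x ((hφ.memSobolev_sum hm s x).continuous hm)]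
  refine Finset.sum_congr rfl fun ν hν => ?_
  rw [Model.V_comm, hφ.V_sum_eigen hm, if_pos hν, sq]

lemma U_sum (hm : 1 ≤ m) (hφ : M.IsEigenSystem φ ρ) (s : Finset ℕ) (x : ℕ → ℝ) {q : I → ℝ}
    (hq : MemSobolev m q) :
    U m (fun t => ∑ ν ∈ s, x ν * φ ν t) q = ∑ ν ∈ s, x ν * (ρ ν * M.V (φ ν) q) := by
  rw [U_sum_left hm s x (fun ν _ => hφ.mem ν) hq]
  exact Finset.sum_congr rfl fun ν _ => by rw [(hφ.isEigen ν).2 q hq]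

lemma U_sum_self (hm : 1 ≤ m) (hφ : M.IsEigenSystem φ ρ) (s : Finset ℕ) (x : ℕ → ℝ) :
    U m (fun t => ∑ ν ∈ s, x ν * φ ν t) (fun t => ∑ ν ∈ s, x ν * φ ν t)
      = ∑ ν ∈ s, ρ ν * x ν ^ 2 := by
  rw [hφ.U_sum hm s x (hφ.memSobolev_sum hm s x)]
  refine Finset.sum_congr rfl fun ν hν => ?_
  rw [Model.V_comm, hφ.V_sum_eigen hm, if_pos hν]
  ring

/-- The eigenvalues grow at least like `ν ^ (2 m)`. -/
lemma exists_growth (hm : 1 ≤ m) (hφ : M.IsEigenSystem φ ρ) :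
    ∃ c, 0 < c ∧ ∀ N k : ℕ, 1 ≤ N → m * N ≤ k → c * (N : ℝ) ^ (2 * m) ≤ ρ k := by
  obtain ⟨C, hC, hVC⟩ := Model.V_self_le (M := M) hm
  refine ⟨C⁻¹, inv_pos.2 hC, fun N k hN hk => ?_⟩
  -- Requiring the derivatives of order below `m` to vanish at the grid points i/N, i < N, imposes m
  -- N linear conditions on k + 1 > m N coefficients. A nonzero solution `f` satisfies V(f,f) ≤ C
  -- N^(-2m) U(f,f) ≤ C N^(-2m) ρ_k V(f,f).
  let T : (Fin (k + 1) → ℝ) →ₗ[ℝ] (Fin m × Fin N → ℝ) :=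
    { toFun := fun x p => ∑ ν, x ν * D p.1 (φ ν) ((p.2 : ℕ) / (N : ℝ))
      map_add' := fun x y => by
        funext p
        simp only [Pi.add_apply, add_mul, Finset.sum_add_distrib]
      map_smul' := fun a x => by
        funext p
        simp only [Pi.smul_apply, smul_eq_mul, Finset.mul_sum, mul_assoc, RingHom.id_apply] }
  have hker : LinearMap.ker T ≠ ⊥ := by
    refine LinearMap.ker_ne_bot_of_finrank_lt ?_
    simp only [Module.finrank_fintype_fun_eq_card, Fintype.card_prod, Fintype.card_fin]
    omega
  obtain ⟨x, hxT, hx0⟩ := Submodule.exists_mem_ne_zero_of_ne_bot hker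
  rw [LinearMap.mem_ker] at hxT
  let y : ℕ → ℝ := fun ν => if h : ν < k + 1 then x ⟨ν, h⟩ else 0
  have hyx : ∀ i : Fin (k + 1), y i = x i := fun i => dif_pos i.2
  set f : I → ℝ := fun t => ∑ ν ∈ Finset.range (k + 1), y ν * φ ν t
  have hf : MemSobolev m f := hφ.memSobolev_sum hm _ y
  have hN0 : (0 : ℝ) < N := by exact_mod_cast hN
  have hzero : ∀ j < m, ∀ i < N, D j f ((i : ℝ) / N) = 0 := by
    intro j hj i hi
    have h1 := congrFun hxT (⟨j, hj⟩, ⟨i, hi⟩)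
    rw [D_sum y (fun ν _ => hφ.mem ν) hj
      ⟨by positivity, (div_le_one hN0).2 (by exact_mod_cast hi.le)⟩, Finset.sum_range]
    simp only [hyx]
    exact h1
  have h1 := hf.isPrimitiveChain.integral_sq_le_of_grid hN hzero
  rw [← U_self_eq (m := m), ← integral_unitInterval] at h1
  simp only [D_zero_apply] at h1
  have h2 := hVC f (hf.continuous hm)
  have hV : M.V f f = ∑ ν ∈ Finset.range (k + 1), y ν ^ 2 := hφ.V_sum_self hm _ y
  have hU : U m f f = ∑ ν ∈ Finset.range (k + 1), ρ ν * y ν ^ 2 := hφ.U_sum_self hm _ y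
  have hUV : U m f f ≤ ρ k * M.V f f := by
    rw [hU, hV, Finset.mul_sum]
    exact Finset.sum_le_sum fun ν hν => mul_le_mul_of_nonneg_right
      (hφ.monotone (by have := Finset.mem_range.1 hν; omega)) (sq_nonneg _)
  have hVpos : 0 < M.V f f := by
    obtain ⟨i, hi⟩ := Function.ne_iff.1 hx0
    rw [hV]
    refine Finset.sum_pos' (fun _ _ => sq_nonneg _) ⟨i, Finset.mem_range.2 i.2, ?_⟩
    rw [hyx]
    exact sq_pos_iff.2 hi
  have h3 : M.V f f ≤ C * (((N : ℝ) ^ (2 * m))⁻¹ * (ρ k * M.V f f)) :=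
    h2.trans (mul_le_mul_of_nonneg_left (h1.trans (mul_le_mul_of_nonneg_left hUV (by positivity)))
      hC.le)
  have h4 : 1 ≤ C * (((N : ℝ) ^ (2 * m))⁻¹ * ρ k) := by
    refine le_of_mul_le_mul_right ?_ hVpos
    linarith
  have h5 : 0 < (N : ℝ) ^ (2 * m) := by positivity
  rw [inv_mul_le_iff₀ hC]
  calc (N : ℝ) ^ (2 * m) = (N : ℝ) ^ (2 * m) * 1 := by ring
    _ ≤ (N : ℝ) ^ (2 * m) * (C * (((N : ℝ) ^ (2 * m))⁻¹ * ρ k)) :=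
      mul_le_mul_of_nonneg_left h4 h5.le
    _ = C * ρ k := by field_simp

lemma rho_pos (hm : 1 ≤ m) (hφ : M.IsEigenSystem φ ρ) {ν : ℕ} (hν : m ≤ ν) : 0 < ρ ν := by
  obtain ⟨c, hc, h⟩ := hφ.exists_growth hm
  have := h 1 ν le_rfl (by simpa using hν)
  simp only [Nat.cast_one, one_pow, mul_one] at this
  exact hc.trans_le this

/-- By exhaustiveness `q`, an eigenfunction for 0, is a finite combination of the `φ ν`. Where ρ_ν >
0 its coefficient vanishes, because 0 = U(φ_ν, q) = ρ_ν V(φ_ν, q). -/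
lemma eq_sum_of_U_eq_zero (hm : 1 ≤ m) (hφ : M.IsEigenSystem φ ρ) {k : ℕ}
    (hk : ∀ ν, k ≤ ν → 0 < ρ ν) {q : I → ℝ} (hq : MemSobolev m q) (hq0 : U m q q = 0) (t : I) :
    q t = ∑ ν ∈ Finset.range k, M.V q (φ ν) * φ ν t := by
  have hspan := hφ.exhaustive 0 q ⟨hq, fun h _ => by rw [U_eq_zero hq hq0, zero_mul]⟩
  obtain ⟨c, hc⟩ := (Finsupp.mem_span_range_iff_exists_finsupp).1 hspan
  have hq' : q = fun t => ∑ ν ∈ c.support, c ν * φ ν t := by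
    rw [← hc]
    funext t
    simp [Finsupp.sum, Finset.sum_apply]
  have hcoef : ∀ ν, M.V q (φ ν) = c ν := by
    intro ν
    rw [hq', hφ.V_sum_eigen hm]
    split_ifs with h
    · rfl
    · exact (Finsupp.notMem_support_iff.1 h).symm
  have hzero : ∀ ν, k ≤ ν → c ν = 0 := by
    intro ν hν
    have h1 := (hφ.isEigen ν).2 q hq
    rw [U_comm, U_eq_zero hq hq0, Model.V_comm, hcoef] at h1
    exact (mul_eq_zero.1 h1.symm).resolve_left (hk ν hν).ne'
  simp only [hcoef]
  rw [hq']
  refine Finset.sum_subset (fun ν hν => ?_) fun ν _ hν => ?_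
  · by_contra h
    exact Finsupp.mem_support_iff.1 hν (hzero ν (by simpa using h))
  · rw [Finsupp.notMem_support_iff.1 hν, zero_mul]

-- If ρ_k > 0 for some k < m, the null space of `U` would be spanned by `k` functions. It contains
-- the polynomials of degree below `m`, an `m`-dimensional space, so some nonzero polynomial would
-- have all its coefficients zero and vanish on [0,1].
open Polynomial in
lemma rho_eq_zero (hm : 1 ≤ m) (hφ : M.IsEigenSystem φ ρ) {k : ℕ} (hk : k < m) : ρ k = 0 := by
  by_contra hne
  have hpos : ∀ ν, k ≤ ν → 0 < ρ ν := fun ν hν =>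
    ((hφ.rho_nonneg k).lt_of_ne' hne).trans_le (hφ.monotone hν)
  let T : (Fin m → ℝ) →ₗ[ℝ] (Fin k → ℝ) :=
    { toFun := fun x ν => ∑ j, x j * M.V (fun t : I => (X ^ (j : ℕ) : ℝ[X]).eval (t : ℝ)) (φ ν)
      map_add' := fun x y => by
        funext p
        simp only [Pi.add_apply, add_mul, Finset.sum_add_distrib]
      map_smul' := fun a x => by
        funext p
        simp only [Pi.smul_apply, smul_eq_mul, Finset.mul_sum, mul_assoc, RingHom.id_apply] }
  have hker : LinearMap.ker T ≠ ⊥ := by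
    refine LinearMap.ker_ne_bot_of_finrank_lt ?_
    simpa using hk
  obtain ⟨x, hxT, hx0⟩ := Submodule.exists_mem_ne_zero_of_ne_bot hker
  rw [LinearMap.mem_ker] at hxT
  refine hx0 ?_
  set p : ℝ[X] := ∑ j : Fin m, C (x j) * X ^ (j : ℕ)
  have hp : ∀ t : ℝ, p.eval t = ∑ j : Fin m, x j * (X ^ (j : ℕ) : ℝ[X]).eval t := fun t => by
    simp [p, eval_finsetSum]
  have hdeg : p.natDegree < m := by
    refine lt_of_le_of_lt (natDegree_sum_le_of_forall_le (n := m - 1) _ _ fun j _ => ?_)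
      (by omega)
    exact (natDegree_C_mul_X_pow_le _ _).trans (by omega)
  have hV : ∀ ν ∈ Finset.range k, M.V (fun t : I => p.eval (t : ℝ)) (φ ν) = 0 := by
    intro ν hν
    have h1 := congrFun hxT ⟨ν, Finset.mem_range.1 hν⟩
    simp only [hp]
    rw [Model.V_sum_left hm _ _ (fun j _ => (memSobolev_polynomial hm _).continuous hm)
      ((hφ.mem ν).continuous hm)]
    exact h1
  have hzero : ∀ t : I, p.eval (t : ℝ) = 0 := by
    intro t
    rw [hφ.eq_sum_of_U_eq_zero hm hpos (memSobolev_polynomial hm p)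
      (U_polynomial_eq_zero hm hdeg) t]
    exact Finset.sum_eq_zero fun ν hν => by rw [hV ν hν, zero_mul]
  have hp0 : p = 0 := by
    refine eq_zero_of_infinite_isRoot p ((Icc_infinite (zero_lt_one' ℝ)).mono fun t ht => ?_)
    exact hzero ⟨t, ht⟩
  funext j
  have := congrArg (fun q : ℝ[X] => q.coeff j) hp0
  simpa [p, finsetSum_coeff, coeff_C_mul, coeff_X_pow, Fin.val_inj] using this

/-- Functions in the null space of `U` are combinations of the first `m` eigenfunctions. -/
lemma null_eq_sum (hm : 1 ≤ m) (hφ : M.IsEigenSystem φ ρ) {q : I → ℝ} (hq : MemSobolev m q)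
    (hq0 : U m q q = 0) : q = fun t => ∑ ν ∈ Finset.range m, M.V q (φ ν) * φ ν t :=
  funext fun t => hφ.eq_sum_of_U_eq_zero hm (fun _ hν => hφ.rho_pos hm hν) hq hq0 t

lemma isNullProj_sum (hm : 1 ≤ m) (hφ : M.IsEigenSystem φ ρ) {f : I → ℝ} (hf : MemSobolev m f) :
    M.IsNullProj f (fun t => ∑ ν ∈ Finset.range m, M.V f (φ ν) * φ ν t) := by
  have hmem := hφ.memSobolev_sum hm (Finset.range m) fun ν => M.V f (φ ν)
  refine ⟨⟨hmem, ?_⟩, fun q hq hq0 => ?_⟩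
  · rw [hφ.U_sum_self hm]
    exact Finset.sum_eq_zero fun ν hν => by
      rw [hφ.rho_eq_zero hm (Finset.mem_range.1 hν), zero_mul]
  · have hqc := hq.continuous hm
    rw [Model.V_sub_left hm (hf.continuous hm) (hmem.continuous hm) hqc, hφ.V_sum hm _ _ hqc,
      Model.V_comm f q]
    have h1 : M.V q f = ∑ ν ∈ Finset.range m, M.V q (φ ν) * M.V (φ ν) f := by
      conv_lhs => rw [hφ.null_eq_sum hm hq hq0]
      exact hφ.V_sum hm _ _ (hf.continuous hm)
    rw [h1, sub_eq_zero]
    refine Finset.sum_congr rfl fun ν _ => ?_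
    rw [Model.V_comm (φ ν) f, Model.V_comm (φ ν) q, mul_comm]

/-- `dagger` is a choice, so uniqueness matters: any null projection is determined by its
`V`-coefficients on the first `m` eigenfunctions, and these are the coefficients of `f`. -/
lemma dagger_eq (hm : 1 ≤ m) (hφ : M.IsEigenSystem φ ρ) {f : I → ℝ} (hf : MemSobolev m f) :
    M.dagger f = fun t => ∑ ν ∈ Finset.range m, M.V f (φ ν) * φ ν t := by
  have h : M.IsNullProj f (M.dagger f) := Classical.epsilon_spec ⟨_, hφ.isNullProj_sum hm hf⟩
  rw [hφ.null_eq_sum hm h.1.1 h.1.2]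
  funext t
  refine Finset.sum_congr rfl fun ν hν => ?_
  have hU : U m (φ ν) (φ ν) = 0 := by
    rw [(hφ.isEigen ν).2 _ (hφ.mem ν), hφ.rho_eq_zero hm (Finset.mem_range.1 hν), zero_mul]
  have h1 := h.2 (φ ν) (hφ.mem ν) hU
  rw [Model.V_sub_left hm (hf.continuous hm) (h.1.1.continuous hm) ((hφ.mem ν).continuous hm),
    sub_eq_zero] at h1
  rw [h1]

lemma normSq_eq (hm : 1 ≤ m) (hφ : M.IsEigenSystem φ ρ) (lam : ℝ) {f : I → ℝ}
    (hf : MemSobolev m f) : M.normSq lam f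
      = M.V f f + lam * (∑ ν ∈ Finset.range m, M.V f (φ ν) ^ 2 + U m f f) := by
  rw [Model.normSq, Model.J, hφ.dagger_eq hm hf, hφ.V_sum_self hm]

open Polynomial in
/-- The derivatives of order less than `m` are bounded by the norm of the Sobolev space. -/
lemma exists_sobolev_bound (hm : 1 ≤ m) (hφ : M.IsEigenSystem φ ρ) :
    ∃ C, 0 ≤ C ∧ ∀ f, MemSobolev m f → ∀ j < m, ∀ x ∈ Icc (0 : ℝ) 1,
      D j f x ^ 2 ≤ C * (M.V f f + U m f f) := by
  obtain ⟨Cw, hCw, hVC⟩ := Model.V_self_le (M := M) hm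
  have hB : ∀ j : ℕ, ∃ B, 0 ≤ B ∧ (j < m → ∀ x ∈ Icc (0 : ℝ) 1,
      ∑ ν ∈ Finset.range m, D j (φ ν) x ^ 2 ≤ B) := by
    intro j
    by_cases hj : j < m
    · obtain ⟨B, hB⟩ := isCompact_Icc.exists_bound_of_continuousOn
        (continuousOn_finsetSum (Finset.range m)
          fun ν _ => ((hφ.mem ν).continuousOn_D hj).pow 2)
      exact ⟨|B|, abs_nonneg _, fun _ x hx =>
        (le_abs_self _).trans ((hB x hx).trans (le_abs_self _))⟩
    · exact ⟨0, le_rfl, fun h => absurd h hj⟩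
  choose B' hB'0 hB' using hB
  set B := ∑ j ∈ Finset.range m, B' j
  have hB0 : 0 ≤ B := Finset.sum_nonneg fun j _ => hB'0 j
  have hBB : ∀ j < m, ∀ x ∈ Icc (0 : ℝ) 1, ∑ ν ∈ Finset.range m, D j (φ ν) x ^ 2 ≤ B :=
    fun j hj x hx => (hB' j hj x hx).trans
      (Finset.single_le_sum (fun j _ => hB'0 j) (Finset.mem_range.2 hj))
  -- Split `f = P + r` with `P` the Taylor polynomial at 0 of degree below `m`. The remainder obeys
  -- |r^(j)|² ≤ U(f,f), and |P^(j)|² ≤ B V(P,P) with V(P,P) ≤ 2 V(f,f) + 2 Cw U(f,f).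
  refine ⟨2 + 2 * (B * (2 + 2 * Cw)), by positivity, fun f hf j hj x hx => ?_⟩
  set p : ℝ[X] := ∑ i ∈ Finset.range m, C (D i f 0 / (i.factorial : ℝ)) * X ^ i
  have hdeg : p.natDegree < m := by
    refine lt_of_le_of_lt (natDegree_sum_le_of_forall_le (n := m - 1) _ _ fun j hj => ?_)
      (by omega)
    have := Finset.mem_range.1 hj
    exact (natDegree_C_mul_X_pow_le _ _).trans (by omega)
  set P : I → ℝ := fun t => p.eval (t : ℝ)
  have hP : MemSobolev m P := memSobolev_polynomial hm p
  have hPU : U m P P = 0 := U_polynomial_eq_zero hm hdeg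
  have hP0 : ∀ i < m, D i P 0 = D i f 0 := by
    intro i hi
    rw [(isPrimitiveChain_polynomial m p).D_eq (f := P) (fun _ => rfl) i hi 0 (by simp),
      ← coeff_zero_eq_eval_zero, coeff_iterate_derivative]
    have : (i.factorial : ℝ) ≠ 0 := by positivity
    simp [p, finsetSum_coeff, coeff_C_mul, coeff_X_pow, hi, Nat.descFactorial_self]
    field_simp
  set r : I → ℝ := fun t => f t - P t
  have hr : MemSobolev m r := hf.sub hm hP
  have hrU : U m r r = U m f f := by
    rw [U_sub_self hm hf hP, hPU, U_comm f P, U_eq_zero hP hPU]; ring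
  have hr0 : ∀ i < m, D i r 0 = 0 := fun i hi => by
    rw [D_sub hf hP hi (by simp), hP0 i hi, sub_self]
  have hrb : ∀ i < m, ∀ y ∈ Icc (0 : ℝ) 1, D i r y ^ 2 ≤ U m f f := fun i hi y hy => by
    rw [← hrU, U_self_eq]
    exact hr.isPrimitiveChain.sq_le hr0 hi hy
  have hrV : M.V r r ≤ Cw * U m f f := by
    refine (hVC r (hr.continuous hm)).trans (mul_le_mul_of_nonneg_left ?_ hCw.le)
    have hi : Integrable (fun x : I => r x ^ 2) :=
      ((hr.continuous hm).pow 2).integrable_of_hasCompactSupport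
        (HasCompactSupport.of_compactSpace _)
    have := integral_mono hi (integrable_const (U m f f)) fun t : I => by
      have := hrb 0 (by omega) t t.2
      rwa [D_zero_apply] at this
    simpa using this
  have hPV : M.V P P ≤ 2 * M.V f f + 2 * M.V r r := by
    have e1 := Model.V_sub_self (M := M) hm (hf.continuous hm) (hr.continuous hm)
    have e2 : (fun t => f t - r t) = P := by funext t; simp [r]
    rw [e2] at e1
    -- Nonnegativity of `V` at f + r, written as f - (-1) r to reuse the formula for differences,
    -- bounds the cross term in V(f - r, f - r).
    have e3 := Model.V_self_nonneg (M := M) hm fun t => f t - (-1) * r t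
    have e4 := Model.V_sub_self (M := M) hm (hf.continuous hm)
      (g := fun t => (-1) * r t) ((hr.continuous hm).const_mul _)
    have e5 : M.V f (fun t => -1 * r t) = - M.V f r := by
      simp only [Model.V_eq]
      rw [← integral_neg]
      exact integral_congr_ae (.of_forall fun x => by ring)
    have e6 : M.V (fun t => -1 * r t) (fun t => -1 * r t) = M.V r r := by
      simp only [Model.V_eq]
      exact integral_congr_ae (.of_forall fun x => by ring)
    rw [e4, e5, e6] at e3
    linarith
  have hPD : D j P x ^ 2 ≤ M.V P P * B := by
    have e1 : P = fun t => ∑ ν ∈ Finset.range m, M.V P (φ ν) * φ ν t := hφ.null_eq_sum hm hP hPU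
    have e2 : D j P x = ∑ ν ∈ Finset.range m, M.V P (φ ν) * D j (φ ν) x := by
      conv_lhs => rw [e1]
      exact D_sum _ (fun ν _ => hφ.mem ν) hj hx
    have e3 : M.V P P = ∑ ν ∈ Finset.range m, M.V P (φ ν) ^ 2 := by
      conv_lhs => rw [e1]
      exact hφ.V_sum_self hm _ _
    rw [e2]
    refine (Finset.sum_mul_sq_le_sq_mul_sq _ _ _).trans ?_
    rw [e3]
    exact mul_le_mul_of_nonneg_left (hBB j hj x hx) (Finset.sum_nonneg fun _ _ => sq_nonneg _)
  have hfD : D j f x = D j r x + D j P x := by rw [D_sub hf hP hj hx]; ring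
  have hV0 := Model.V_self_nonneg (M := M) hm f
  have hU0 := U_self_nonneg (m := m) f
  have h1 : D j f x ^ 2 ≤ 2 * D j r x ^ 2 + 2 * D j P x ^ 2 := by
    rw [hfD]; nlinarith [sq_nonneg (D j r x - D j P x)]
  have h2 : M.V P P * B ≤ (2 * M.V f f + 2 * (Cw * U m f f)) * B :=
    mul_le_mul_of_nonneg_right (by linarith) hB0
  have h3 := hrb j hj x hx
  have h4 : 0 ≤ B * Cw * M.V f f := by positivity
  have h5 : 0 ≤ B * U m f f := by positivity
  nlinarith

end Model.IsEigenSystem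

end SplineBayes

/-! ### Series in the eigenfunctions -/

namespace SplineBayes

lemma inner_toLp {α : Type*} [MeasurableSpace α] {μ : Measure α} {f : α → ℝ} (hf : MemLp f 2 μ)
    (h : Lp ℝ 2 μ) : inner ℝ (hf.toLp f) h = ∫ x, f x * h x ∂μ := by
  rw [L2.inner_def]
  refine integral_congr_ae ?_
  filter_upwards [hf.coeFn_toLp] with x hx
  rw [hx]
  simp [mul_comm]

variable {m : ℕ} {M : Model m}

namespace Model.IsEigenSystem

variable {φ : ℕ → I → ℝ} {ρ : ℕ → ℝ}

lemma bessel_V (hm : 1 ≤ m) (hφ : M.IsEigenSystem φ ρ) {q : I → ℝ} (hq : MemSobolev m q) :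
    Summable fun ν => M.V q (φ ν) ^ 2 := by
  refine summable_of_sum_le (fun _ => sq_nonneg _) (c := M.V q q) fun s => ?_
  have hqc := hq.continuous hm
  have hS := (hφ.memSobolev_sum hm s fun ν => M.V q (φ ν)).continuous hm
  have h0 := Model.V_self_nonneg (M := M) hm
    fun t => q t - ∑ ν ∈ s, M.V q (φ ν) * φ ν t
  rw [Model.V_sub_self hm hqc hS, hφ.V_sum_self hm,
    Model.V_comm q (fun t => ∑ ν ∈ s, M.V q (φ ν) * φ ν t), hφ.V_sum hm s _ hqc] at h0
  have h1 : ∑ ν ∈ s, M.V q (φ ν) * M.V (φ ν) q = ∑ ν ∈ s, M.V q (φ ν) ^ 2 :=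
    Finset.sum_congr rfl fun ν _ => by rw [Model.V_comm (φ ν), sq]
  rw [h1] at h0
  linarith

lemma bessel_U (hm : 1 ≤ m) (hφ : M.IsEigenSystem φ ρ) {q : I → ℝ} (hq : MemSobolev m q) :
    Summable fun ν => ρ ν * M.V q (φ ν) ^ 2 := by
  refine summable_of_sum_le (fun ν => mul_nonneg (hφ.rho_nonneg ν) (sq_nonneg _))
    (c := U m q q) fun s => ?_
  have hS := hφ.memSobolev_sum hm s fun ν => M.V q (φ ν)
  have h0 := U_self_nonneg (m := m) fun t => q t - ∑ ν ∈ s, M.V q (φ ν) * φ ν t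
  rw [U_sub_self hm hq hS, hφ.U_sum_self hm,
    U_comm q (fun t => ∑ ν ∈ s, M.V q (φ ν) * φ ν t), hφ.U_sum hm s _ hq] at h0
  have h1 : ∑ ν ∈ s, M.V q (φ ν) * (ρ ν * M.V (φ ν) q) = ∑ ν ∈ s, ρ ν * M.V q (φ ν) ^ 2 :=
    Finset.sum_congr rfl fun ν _ => by rw [Model.V_comm (φ ν)]; ring
  rw [h1] at h0
  linarith

/-- The function with coefficients `x` in the eigen-system. -/
noncomputable abbrev series (φ : ℕ → I → ℝ) (x : ℕ → ℝ) (t : I) : ℝ := ∑' ν, x ν * φ ν t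

section

variable {x : ℕ → ℝ}

lemma exists_sum_D_bound (hm : 1 ≤ m) (hφ : M.IsEigenSystem φ ρ) :
    ∃ C, 0 ≤ C ∧ ∀ (x : ℕ → ℝ) (s : Finset ℕ), ∀ j < m, ∀ t ∈ Icc (0 : ℝ) 1,
      (∑ ν ∈ s, x ν * D j (φ ν) t) ^ 2 ≤ C * ∑ ν ∈ s, (1 + ρ ν) * x ν ^ 2 := by
  obtain ⟨C, hC, h⟩ := hφ.exists_sobolev_bound hm
  refine ⟨C, hC, fun x s j hj t ht => ?_⟩
  have h1 := h _ (hφ.memSobolev_sum hm s x) j hj t ht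
  rw [D_sum x (fun ν _ => hφ.mem ν) hj ht, hφ.V_sum_self hm, hφ.U_sum_self hm,
    ← Finset.sum_add_distrib] at h1
  simpa only [add_mul, one_mul] using h1

lemma summable_D (hm : 1 ≤ m) (hφ : M.IsEigenSystem φ ρ)
    (hx : Summable fun ν => (1 + ρ ν) * x ν ^ 2) {j : ℕ} (hj : j < m) {t : ℝ}
    (ht : t ∈ Icc (0 : ℝ) 1) : Summable fun ν => x ν * D j (φ ν) t := by
  obtain ⟨C, hC, h⟩ := hφ.exists_sum_D_bound hm
  rw [summable_iff_vanishing_norm] at hx ⊢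
  intro ε hε
  -- The Sobolev bound on finite sums yields the Cauchy criterion; `C + 1` is used because `C` may
  -- be zero.
  obtain ⟨s, hs⟩ := hx (ε ^ 2 / (C + 1)) (by positivity)
  refine ⟨s, fun t' ht' => abs_lt_of_sq_lt_sq ?_ hε.le⟩
  have h1 := (Real.le_norm_self _).trans_lt (hs t' ht')
  have h2 := h x t' j hj t ht
  rw [lt_div_iff₀ (by positivity)] at h1
  have h3 : 0 ≤ ∑ ν ∈ t', (1 + ρ ν) * x ν ^ 2 := Finset.sum_nonneg fun ν _ =>
    mul_nonneg (by linarith [hφ.rho_nonneg ν]) (sq_nonneg _)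
  nlinarith

lemma exists_abs_sum_D_le (hm : 1 ≤ m) (hφ : M.IsEigenSystem φ ρ)
    (hx : Summable fun ν => (1 + ρ ν) * x ν ^ 2) :
    ∃ B, ∀ s : Finset ℕ, ∀ j < m, ∀ t ∈ Icc (0 : ℝ) 1, |∑ ν ∈ s, x ν * D j (φ ν) t| ≤ B := by
  obtain ⟨C, hC, h⟩ := hφ.exists_sum_D_bound hm
  refine ⟨√(C * ∑' ν, (1 + ρ ν) * x ν ^ 2), fun s j hj t ht => Real.abs_le_sqrt ?_⟩
  refine (h x s j hj t ht).trans (mul_le_mul_of_nonneg_left ?_ hC)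
  exact hx.sum_le_tsum _ fun ν _ => mul_nonneg (by linarith [hφ.rho_nonneg ν]) (sq_nonneg _)

/-- The `m`-th derivatives of the eigenfunctions are orthogonal in L² with squared norms ρ_ν, so the
squared norm of a finite sum is ∑ ρ_ν x_ν². -/
lemma summable_toLp_D (hφ : M.IsEigenSystem φ ρ)
    (hx : Summable fun ν => (1 + ρ ν) * x ν ^ 2) :
    Summable fun ν => x ν • ((hφ.mem ν).memLp_deriv.toLp (D m (φ ν))) := by
  have hinner : ∀ μ ν, inner ℝ ((hφ.mem μ).memLp_deriv.toLp (D m (φ μ)))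
      ((hφ.mem ν).memLp_deriv.toLp (D m (φ ν))) = if μ = ν then ρ μ else 0 := by
    intro μ ν
    have h1 : ∫ t in Icc (0 : ℝ) 1, D m (φ μ) t * D m (φ ν) t = if μ = ν then ρ μ else 0 := by
      have := (hφ.isEigen μ).2 _ (hφ.mem ν)
      rw [hφ.orthonormal, mul_ite, mul_one, mul_zero] at this
      exact this
    rw [inner_toLp, ← h1]
    refine integral_congr_ae ?_
    filter_upwards [(hφ.mem ν).memLp_deriv.coeFn_toLp] with t ht
    rw [ht]
  rw [summable_iff_vanishing_norm] at hx ⊢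
  intro ε hε
  obtain ⟨s, hs⟩ := hx (ε ^ 2) (by positivity)
  refine ⟨s, fun t ht => lt_of_pow_lt_pow_left₀ 2 hε.le ?_⟩
  refine lt_of_le_of_lt ?_ ((Real.le_norm_self _).trans_lt (hs t ht))
  rw [← real_inner_self_eq_norm_sq, sum_inner]
  refine Finset.sum_le_sum fun ν hν => ?_
  simp only [inner_sum, real_inner_smul_left, real_inner_smul_right, hinner]
  simp only [mul_ite, mul_zero, Finset.sum_ite_eq, hν, if_true]
  nlinarith [sq_nonneg (x ν)]

-- Termwise differentiation: the sums of the derivatives form a chain with the L² sum `h` on top.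
-- The integral relation passes to the limit by dominated convergence below the top, and by pairing
-- with the indicator of (0,t] in L² at the top.
open Filter Topology in
lemma exists_chain (hm : 1 ≤ m) (hφ : M.IsEigenSystem φ ρ)
    (hx : Summable fun ν => (1 + ρ ν) * x ν ^ 2) :
    ∃ h : Lp ℝ 2 (volume.restrict (Icc (0 : ℝ) 1)),
      HasSum (fun ν => x ν • ((hφ.mem ν).memLp_deriv.toLp (D m (φ ν)))) h ∧
      IsPrimitiveChain m (fun j t => if j < m then ∑' ν, x ν * D j (φ ν) t else h t) := by
  obtain ⟨h, hh⟩ := hφ.summable_toLp_D hx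
  refine ⟨h, hh, ?_⟩
  obtain ⟨B, hB⟩ := hφ.exists_abs_sum_D_le hm hx
  set g : ℕ → ℝ → ℝ := fun j t => if j < m then ∑' ν, x ν * D j (φ ν) t else h t
  have hgm : g m = h := by funext t; simp [g]
  have hg : ∀ j < m, ∀ t ∈ Icc (0 : ℝ) 1, HasSum (fun ν => x ν * D j (φ ν) t) (g j t) := by
    intro j hj t ht
    simpa only [g, if_pos hj] using (hφ.summable_D hm hx hj ht).hasSum
  have hsm : ∀ (s : Finset ℕ), ∀ j < m, AEStronglyMeasurable
      (fun t => ∑ ν ∈ s, x ν * D j (φ ν) t) (volume.restrict (Icc (0 : ℝ) 1)) := fun s j hj =>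
    (continuousOn_finsetSum s fun ν _ => continuousOn_const.mul
      ((hφ.mem ν).continuousOn_D hj)).aestronglyMeasurable measurableSet_Icc
  have hint : ∀ j ≤ m, IntegrableOn (g j) (Icc (0 : ℝ) 1) := by
    intro j hj
    rcases hj.eq_or_lt with rfl | hj
    · rw [hgm]; exact (Lp.memLp h).integrable (by norm_num)
    · have hmeas : AEStronglyMeasurable (g j) (volume.restrict (Icc (0 : ℝ) 1)) :=
        aestronglyMeasurable_of_tendsto_ae atTop (fun s => hsm s j hj)
          ((ae_restrict_iff' measurableSet_Icc).2 (.of_forall fun t ht => hg j hj t ht))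
      refine Integrable.of_bound hmeas B
        ((ae_restrict_iff' measurableSet_Icc).2 (.of_forall fun t ht => ?_))
      exact le_of_tendsto (hg j hj t ht).norm (.of_forall fun s => hB s j hj t ht)
  refine ⟨fun j hj => hint (j + 1) hj, by rw [hgm]; exact Lp.memLp h, fun j hj t ht => ?_⟩
  have h0 : (0 : ℝ) ∈ Icc (0 : ℝ) 1 := by simp
  have hDint : ∀ ν, IntervalIntegrable (D (j + 1) (φ ν)) volume 0 t := fun ν =>
    intervalIntegrable_of_integrableOn_Icc ((hφ.mem ν).isPrimitiveChain.integrableOn j hj) h0 ht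
  have hsum : HasSum (fun ν => x ν * ∫ s in (0 : ℝ)..t, D (j + 1) (φ ν) s)
      (∫ s in (0 : ℝ)..t, g (j + 1) s) := by
    by_cases hj' : j + 1 < m
    · have h1 : ∀ s : Finset ℕ, ∑ ν ∈ s, x ν * ∫ r in (0 : ℝ)..t, D (j + 1) (φ ν) r
          = ∫ r in (0 : ℝ)..t, ∑ ν ∈ s, x ν * D (j + 1) (φ ν) r := by
        intro s
        rw [intervalIntegral.integral_finsetSum fun ν _ => (hDint ν).const_mul _]
        simp_rw [intervalIntegral.integral_const_mul]
      have hsub : uIoc 0 t ⊆ Icc (0 : ℝ) 1 := by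
        rw [uIoc_of_le ht.1]
        exact Ioc_subset_Icc_self.trans (Icc_subset_Icc le_rfl ht.2)
      change Tendsto (fun s : Finset ℕ => ∑ ν ∈ s, _) atTop _
      simp_rw [h1]
      refine intervalIntegral.tendsto_integral_filter_of_dominated_convergence (fun _ => B)
        (.of_forall fun s => (hsm s _ hj').mono_set hsub)
        (.of_forall fun s => .of_forall fun r hr => hB s _ hj' r (hsub hr)) (by simp)
        (.of_forall fun r hr => hg _ hj' r (hsub hr))
    · have hjm : j + 1 = m := by omega
      have hw : MemLp ((Ioc 0 t).indicator fun _ : ℝ => (1 : ℝ)) 2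
          (volume.restrict (Icc (0 : ℝ) 1)) :=
        (memLp_const 1).indicator measurableSet_Ioc
      have h1 : ∀ k : ℝ → ℝ, ∫ r in Icc (0 : ℝ) 1, (Ioc 0 t).indicator (fun _ => (1 : ℝ)) r * k r
          = ∫ r in (0 : ℝ)..t, k r := by
        intro k
        rw [intervalIntegral.integral_of_le ht.1, ← integral_indicator measurableSet_Ioc]
        rw [← integral_indicator measurableSet_Icc]
        congr 1
        funext r
        simp only [indicator_apply]
        by_cases hr : r ∈ Ioc 0 t
        · have hr' : r ∈ Icc (0 : ℝ) 1 := ⟨hr.1.le, hr.2.trans ht.2⟩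
          simp only [if_pos hr, if_pos hr', one_mul]
        · simp only [if_neg hr, zero_mul, ite_self]
      have h2 := hh.mapL (innerSL ℝ (hw.toLp _))
      simp only [innerSL_apply_apply, real_inner_smul_right, inner_toLp] at h2
      rw [h1] at h2
      rw [hjm, hgm]
      refine h2.congr_fun fun ν => ?_
      rw [← h1]
      congr 1
      refine integral_congr_ae ?_
      filter_upwards [(hφ.mem ν).memLp_deriv.coeFn_toLp] with r hr
      rw [hr]
  have h2 : HasSum (fun ν => x ν * D j (φ ν) t)
      (g j 0 + ∫ s in (0 : ℝ)..t, g (j + 1) s) := by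
    refine ((hg j hj 0 h0).add hsum).congr_fun fun ν => ?_
    rw [(hφ.mem ν).isPrimitiveChain.ftc j hj t ht]
    ring
  exact (hg j hj t ht).unique h2

lemma summable_series (hm : 1 ≤ m) (hφ : M.IsEigenSystem φ ρ)
    (hx : Summable fun ν => (1 + ρ ν) * x ν ^ 2) (t : I) : Summable fun ν => x ν * φ ν t := by
  simpa only [D_zero_apply] using hφ.summable_D hm hx (j := 0) (by omega) t.2

lemma memSobolev_series (hm : 1 ≤ m) (hφ : M.IsEigenSystem φ ρ)
    (hx : Summable fun ν => (1 + ρ ν) * x ν ^ 2) : MemSobolev m (series φ x) := by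
  obtain ⟨h, -, hc⟩ := hφ.exists_chain hm hx
  exact hc.memSobolev hm fun t => by simp [show 0 < m by omega, D_zero_apply, series]

lemma hasSum_U_series (hm : 1 ≤ m) (hφ : M.IsEigenSystem φ ρ)
    (hx : Summable fun ν => (1 + ρ ν) * x ν ^ 2) {q : I → ℝ} (hq : MemSobolev m q) :
    HasSum (fun ν => x ν * (ρ ν * M.V (φ ν) q)) (U m (series φ x) q) := by
  obtain ⟨h, hh, hc⟩ := hφ.exists_chain hm hx
  have hD := hc.D_ae_eq hm (f := series φ x)
    fun t => by simp [show 0 < m by omega, D_zero_apply, series]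
  have h2 := hh.mapL (innerSL ℝ (hq.memLp_deriv.toLp _))
  simp only [innerSL_apply_apply, real_inner_smul_right, inner_toLp] at h2
  have h3 : U m (series φ x) q = ∫ t in Icc (0 : ℝ) 1, D m q t * h t := by
    refine integral_congr_ae ?_
    filter_upwards [hD] with t ht
    rw [ht]
    simp [mul_comm]
  rw [h3]
  refine h2.congr_fun fun ν => ?_
  rw [← (hφ.isEigen ν).2 q hq]
  congr 1
  refine integral_congr_ae ?_
  filter_upwards [(hφ.mem ν).memLp_deriv.coeFn_toLp] with t ht
  rw [ht, mul_comm]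

-- The partial sums are bounded uniformly on [0,1], so dominated convergence applies in the integral
-- defining `V`.
open Filter Topology in
lemma hasSum_V_series (hm : 1 ≤ m) (hφ : M.IsEigenSystem φ ρ)
    (hx : Summable fun ν => (1 + ρ ν) * x ν ^ 2) {q : I → ℝ} (hq : Continuous q) :
    HasSum (fun ν => x ν * M.V (φ ν) q) (M.V (series φ x) q) := by
  obtain ⟨B, hB⟩ := hφ.exists_abs_sum_D_le hm hx
  have hBt : ∀ (s : Finset ℕ) (t : I), |∑ ν ∈ s, x ν * φ ν t| ≤ B := fun s t => by
    simpa only [D_zero_apply] using hB s 0 (by omega) t t.2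
  have h1 : ∀ s : Finset ℕ, ∑ ν ∈ s, x ν * M.V (φ ν) q
      = ∫ t, M.weight t * ((∑ ν ∈ s, x ν * φ ν t) * q t) := fun s => by
    rw [← hφ.V_sum hm s x hq, Model.V_eq]
  change Tendsto (fun s : Finset ℕ => ∑ ν ∈ s, _) atTop _
  simp_rw [h1]
  rw [Model.V_eq]
  refine tendsto_integral_filter_of_dominated_convergence
    (fun t => M.weight t * (B * |q t|)) (.of_forall fun s => ?_) (.of_forall fun s => ?_) ?_ ?_
  · exact (integrable_V hm ((hφ.memSobolev_sum hm s x).continuous hm) hq).aestronglyMeasurable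
  · refine .of_forall fun t => ?_
    have hw := (M.weight_bounds hm).2.1 t
    rw [norm_mul, norm_mul, Real.norm_of_nonneg hw]
    exact mul_le_mul_of_nonneg_left (mul_le_mul_of_nonneg_right (hBt s t) (abs_nonneg _)) hw
  · exact integrable_V hm (f := fun _ => B) (g := fun t => |q t|) continuous_const hq.abs
  · refine .of_forall fun t => Tendsto.const_mul _ (Tendsto.mul_const _ ?_)
    exact (hφ.summable_series hm hx t).hasSum

/-- On sums of the eigen-series, the squared distance to `q` is a weighted `ℓ²` distance of the
coefficients, up to a constant. -/
lemma exists_hasSum_normSq_sub (hm : 1 ≤ m) (hφ : M.IsEigenSystem φ ρ) (lam : ℝ) {q : I → ℝ}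
    (hq : MemSobolev m q) : ∃ K : ℝ, ∀ x : ℕ → ℝ, Summable (fun ν => (1 + ρ ν) * x ν ^ 2) →
      HasSum (fun ν => (1 + lam * gam m ρ ν) * (x ν - M.V q (φ ν)) ^ 2)
        (M.normSq lam (fun t => series φ x t - q t) - K) := by
  -- `K` collects the defects in Bessel's inequalities for `q`. The terms involving `x` have none,
  -- since V(f, ·) and U(f, ·) are exact sums when `f` is an eigen-series, and the `†` part is a
  -- finite sum.
  refine ⟨(M.V q q - ∑' ν, M.V q (φ ν) ^ 2) + lam * (U m q q - ∑' ν, ρ ν * M.V q (φ ν) ^ 2),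
    fun x hx => ?_⟩
  set f := series φ x
  have hf : MemSobolev m f := hφ.memSobolev_series hm hx
  have hfc := hf.continuous hm
  have hqc := hq.continuous hm
  have hcoef : ∀ μ, M.V f (φ μ) = x μ := by
    intro μ
    refine (hφ.hasSum_V_series hm hx ((hφ.mem μ).continuous hm)).unique ?_
    convert hasSum_ite_eq μ (x μ) using 2 with ν
    rw [hφ.orthonormal]
    split_ifs with h
    · rw [h, mul_one]
    · rw [mul_zero]
  rw [hφ.normSq_eq hm lam (hf.sub hm hq), Model.V_sub_self hm hfc hqc, U_sub_self hm hf hq]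
  have e1 : HasSum _ (M.V f f) := hφ.hasSum_V_series hm hx hfc
  have e2 : HasSum _ (M.V f q) := hφ.hasSum_V_series hm hx hqc
  have e3 := (hφ.bessel_V hm hq).hasSum
  have e4 : HasSum _ (U m f f) := hφ.hasSum_U_series hm hx hf
  have e5 : HasSum _ (U m f q) := hφ.hasSum_U_series hm hx hq
  have e6 := (hφ.bessel_U hm hq).hasSum
  have e7 : HasSum (fun ν => if ν ∈ Finset.range m then (x ν - M.V q (φ ν)) ^ 2 else 0)
      (∑ ν ∈ Finset.range m, M.V (fun t => f t - q t) (φ ν) ^ 2) := by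
    have h1 : ∑ ν ∈ Finset.range m, M.V (fun t => f t - q t) (φ ν) ^ 2 = ∑ ν ∈ Finset.range m,
        if ν ∈ Finset.range m then (x ν - M.V q (φ ν)) ^ 2 else 0 :=
      Finset.sum_congr rfl fun ν hν => by
        rw [if_pos hν, Model.V_sub_left hm hfc hqc ((hφ.mem ν).continuous hm), hcoef]
    rw [h1]
    exact hasSum_sum_of_ne_finset_zero fun ν hν => if_neg hν
  have e := ((e1.sub (e2.mul_left 2)).add e3).add
    ((e7.add ((e4.sub (e5.mul_left 2)).add e6)).mul_left lam)
  have hval : M.V f f - 2 * M.V f q + M.V q q + lam * (∑ ν ∈ Finset.range m,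
      M.V (fun t => f t - q t) (φ ν) ^ 2 + (U m f f - 2 * U m f q + U m q q))
      - (M.V q q - ∑' ν, M.V q (φ ν) ^ 2 + lam * (U m q q - ∑' ν, ρ ν * M.V q (φ ν) ^ 2))
      = M.V f f - 2 * M.V f q + ∑' ν, M.V q (φ ν) ^ 2 + lam * (∑ ν ∈ Finset.range m,
      M.V (fun t => f t - q t) (φ ν) ^ 2
        + (U m f f - 2 * U m f q + ∑' ν, ρ ν * M.V q (φ ν) ^ 2)) := by ring
  rw [hval]
  refine e.congr_fun fun ν => ?_
  rw [Model.V_comm (φ ν) f, hcoef, Model.V_comm (φ ν) q]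
  by_cases hν : ν < m
  · simp only [gam, if_pos hν, Finset.mem_range, hφ.rho_eq_zero hm hν]
    ring
  · simp only [gam, if_neg hν, Finset.mem_range]
    ring

end

end Model.IsEigenSystem

end SplineBayes

/-! ### Measurability on S^m for the evaluation σ-algebra -/

namespace SplineBayes

variable {m : ℕ}

lemma measurable_eval (t : I) : Measurable fun f : Sobolev m => f.1 t :=
  (measurable_pi_apply t).comp (comap_measurable _)

lemma measurable_sobolev_iff {α : Type*} [MeasurableSpace α] {T : α → Sobolev m} :
    Measurable T ↔ ∀ t, Measurable fun a => (T a).1 t := by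
  rw [measurable_comap_iff, measurable_pi_iff]
  rfl

lemma measurable_uncurry_eval (hm : 1 ≤ m) : Measurable fun p : Sobolev m × I => p.1.1 p.2 := by
  have h := measurable_uncurry_of_continuous_of_measurable (u := fun (t : I) (f : Sobolev m) => f.1 t)
    (fun f => f.2.continuous hm) measurable_eval
  exact h.comp measurable_swap

open Filter Topology in
lemma measurable_D (j : ℕ) (hj : j < m) (t : ℝ) :
    Measurable fun f : Sobolev m => D j f.1 t := by
  induction j generalizing t with
  | zero =>
    simp only [D, iteratedDerivWithin_zero]
    exact measurable_eval _
  | succ j ih =>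
    by_cases ht : t ∈ Icc (0 : ℝ) 1
    · have hne : (𝓝[Icc (0 : ℝ) 1 \ {t}] t).NeBot :=
        accPt_principal_iff_nhdsWithin.1 (uniqueDiffOn_Icc zero_lt_one t ht).accPt
      obtain ⟨u, hu⟩ := (𝓝[Icc (0 : ℝ) 1 \ {t}] t).exists_seq_tendsto
      refine measurable_of_tendsto_metrizable
        (f := fun n (f : Sobolev m) => slope (D j f.1) t (u n)) (fun n => ?_) ?_
      · simp only [slope, vsub_eq_sub, smul_eq_mul]
        exact ((ih (by omega) _).sub (ih (by omega) _)).const_mul _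
      · rw [tendsto_pi_nhds]
        intro f
        have h := f.2.isPrimitiveChain.derivWithin_eq hj ht
        rw [hasDerivWithinAt_iff_tendsto_slope] at h
        exact h.comp hu
    · have h0 : ∀ f : Sobolev m, D (j + 1) f.1 t = 0 := fun f => by
        rw [D_succ]
        exact derivWithin_zero_of_notMem_closure (by rwa [isClosed_Icc.closure_eq])
      simp only [h0]
      exact measurable_const

open Filter Topology in
/-- The derivative of order `m` has a jointly measurable version. -/
lemma exists_measurable_D_top (hm : 1 ≤ m) : ∃ H : Sobolev m → ℝ → ℝ,
    Measurable (Function.uncurry H) ∧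
      ∀ f : Sobolev m, D m f.1 =ᵐ[volume.restrict (Icc (0 : ℝ) 1)] H f := by
  obtain ⟨k, rfl⟩ : ∃ k, m = k + 1 := ⟨m - 1, by omega⟩
  let G : Sobolev (k + 1) → ℝ → ℝ := fun f =>
    IccExtend (zero_le_one : (0 : ℝ) ≤ 1) fun t : Icc (0 : ℝ) 1 => D k f.1 t
  have hGc : ∀ f, Continuous (G f) := fun f =>
    (continuousOn_iff_continuous_domRestrict.1
      (f.2.continuousOn_D (j := k) (by omega))).Icc_extend'
  have hGm : ∀ t, Measurable fun f => G f t := fun t => measurable_D k (by omega) _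
  have hG : Measurable (Function.uncurry G) :=
    (measurable_uncurry_of_continuous_of_measurable (u := fun t f => G f t) hGc hGm).comp
      measurable_swap
  let Q : ℕ → Sobolev (k + 1) × ℝ → ℝ := fun n p =>
    ((n : ℝ) + 1) * (G p.1 (p.2 + ((n : ℝ) + 1)⁻¹) - G p.1 p.2)
  have hQ : ∀ n, Measurable (Q n) := fun n => by
    have h1 : Measurable fun p : Sobolev (k + 1) × ℝ => G p.1 (p.2 + ((n : ℝ) + 1)⁻¹) :=
      hG.comp (measurable_fst.prodMk (measurable_snd.add_const _))
    exact (h1.sub hG).const_mul _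
  -- The upper limit is jointly measurable whether or not the quotients converge; they do converge
  -- for almost every `t`, as D^(m-1) f is absolutely continuous.
  refine ⟨fun f t => limsup (fun n => Q n (f, t)) atTop, Measurable.limsup hQ, fun f => ?_⟩
  refine ae_restrict_Icc_of_Ioo ?_
  filter_upwards [(f.2.absCont k (by omega)).ae_differentiableAt] with t ht ht1
  have hd := (ht (by rw [uIcc_of_le zero_le_one]; exact Ioo_subset_Icc_self ht1)).hasDerivAt
  rw [D_succ, derivWithin_Icc_eq_deriv ht1]
  refine (Tendsto.limsup_eq ?_).symm
  have hlim : Tendsto (fun n : ℕ => ((n : ℝ) + 1)⁻¹) atTop (𝓝 0) := by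
    simpa only [one_div] using tendsto_one_div_add_atTop_nhds_zero_nat (𝕜 := ℝ)
  have hlim' : Tendsto (fun n : ℕ => ((n : ℝ) + 1)⁻¹) atTop (𝓝[≠] 0) :=
    tendsto_nhdsWithin_iff.2 ⟨hlim, .of_forall fun n => by simp; positivity⟩
  have h2 := (hasDerivAt_iff_tendsto_slope_zero.1 hd).comp hlim'
  refine h2.congr' ?_
  have hmem : ∀ᶠ n : ℕ in atTop, t + ((n : ℝ) + 1)⁻¹ ∈ Icc (0 : ℝ) 1 := by
    have : Tendsto (fun n : ℕ => t + ((n : ℝ) + 1)⁻¹) atTop (𝓝 t) := by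
      simpa using hlim.const_add t
    exact this.eventually (Icc_mem_nhds ht1.1 ht1.2)
  filter_upwards [hmem] with n hn
  simp only [Function.comp_apply, inv_inv, smul_eq_mul, Q, G]
  rw [IccExtend_of_mem _ _ hn, IccExtend_of_mem _ _ (Ioo_subset_Icc_self ht1)]

lemma measurable_U (hm : 1 ≤ m) {α : Type*} [MeasurableSpace α] {S T : α → Sobolev m}
    (hS : Measurable S) (hT : Measurable T) : Measurable fun a => U m (S a).1 (T a).1 := by
  obtain ⟨H, hH, hHD⟩ := exists_measurable_D_top hm
  have h1 : ∀ f g : Sobolev m, U m f.1 g.1 = ∫ t in Icc (0 : ℝ) 1, H f t * H g t := fun f g => by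
    refine integral_congr_ae ?_
    filter_upwards [hHD f, hHD g] with t h1 h2
    rw [h1, h2]
  simp only [h1]
  have h2 : Measurable (Function.uncurry fun a t => H (S a) t * H (T a) t) :=
    (hH.comp ((hS.comp measurable_fst).prodMk measurable_snd)).mul
      (hH.comp ((hT.comp measurable_fst).prodMk measurable_snd))
  exact h2.stronglyMeasurable.integral_prod_right.measurable

lemma measurable_V (hm : 1 ≤ m) {M : Model m} {α : Type*} [MeasurableSpace α] {S T : α → Sobolev m}
    (hS : Measurable S) (hT : Measurable T) : Measurable fun a => M.V (S a).1 (T a).1 := by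
  have he := measurable_uncurry_eval hm
  simp only [Model.V_eq]
  have h2 : Measurable (Function.uncurry fun a t => M.weight t * ((S a).1 t * (T a).1 t)) :=
    ((M.weight_bounds hm).1.comp measurable_snd).mul
      ((he.comp ((hS.comp measurable_fst).prodMk measurable_snd)).mul
      (he.comp ((hT.comp measurable_fst).prodMk measurable_snd)))
  exact h2.stronglyMeasurable.integral_prod_right.measurable

/-- The norm involves the choice `dagger`; measurability comes from replacing it by the first `m`
eigen-coefficients. -/
lemma Model.IsEigenSystem.measurable_expWeight {M : Model m} {φ : ℕ → I → ℝ} {ρ : ℕ → ℝ}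
    (hm : 1 ≤ m) (hφ : M.IsEigenSystem φ ρ) (lam : ℝ) (n : ℕ) {q : I → ℝ} (hq : MemSobolev m q) :
    Measurable (M.expWeight lam n q) := by
  let T : Sobolev m → Sobolev m := fun f => ⟨fun t => f.1 t - q t, f.2.sub hm hq⟩
  have hT : Measurable T := measurable_sobolev_iff.2 fun t => (measurable_eval t).sub_const _
  have h1 : ∀ f : Sobolev m, M.normSq lam (fun t => f.1 t - q t) = M.V (T f).1 (T f).1
      + lam * (∑ ν ∈ Finset.range m, M.V (T f).1 (φ ν) ^ 2 + U m (T f).1 (T f).1) :=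
    fun f => hφ.normSq_eq hm lam (T f).2
  change Measurable fun f : Sobolev m =>
    Real.exp (-((n : ℝ) / 2) * M.normSq lam (fun t => f.1 t - q t))
  simp only [h1]
  have h2 : ∀ ν, Measurable fun f => M.V (T f).1 (φ ν) := fun ν =>
    measurable_V hm hT (measurable_const (a := (⟨φ ν, hφ.mem ν⟩ : Sobolev m)))
  have h3 : Measurable fun f => ∑ ν ∈ Finset.range m, M.V (T f).1 (φ ν) ^ 2 :=
    Finset.measurable_fun_sum _ fun ν _ => (h2 ν).pow_const 2
  exact Real.measurable_exp.comp
    (((measurable_V hm hT hT).add ((h3.add (measurable_U hm hT hT)).const_mul lam)).const_mul _)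

end SplineBayes

/-! ### Almost sure regularity and transport of the laws to S^m -/

namespace SplineBayes

variable {m : ℕ} {M : Model m} {φ : ℕ → I → ℝ} {ρ : ℕ → ℝ}

lemma tauSq_pos (hm : 1 ≤ m) (hφ : M.IsEigenSystem φ ρ) {sd : ℕ → ℝ} (hsd : ∀ ν < m, 0 < sd ν)
    (β : ℝ) (ν : ℕ) : 0 < tauSq m sd ρ β ν := by
  unfold tauSq
  split_ifs with h
  · have := hsd ν h
    positivity
  · exact Real.rpow_pos_of_pos (hφ.rho_pos hm (by omega)) _

lemma gam_nonneg (hφ : M.IsEigenSystem φ ρ) (ν : ℕ) : 0 ≤ gam m ρ ν := by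
  unfold gam
  split_ifs
  · exact zero_le_one
  · exact hφ.rho_nonneg ν

/-- The grid bound is applied with N = ⌊ν/m⌋, which is at least ν/(2m) once ν ≥ m. -/
lemma exists_rho_ge (hm : 1 ≤ m) (hφ : M.IsEigenSystem φ ρ) :
    ∃ c, 0 < c ∧ ∀ ν, m ≤ ν → c * (ν : ℝ) ^ (2 * m) ≤ ρ ν := by
  obtain ⟨c, hc, h⟩ := hφ.exists_growth hm
  have hm0 : (0 : ℝ) < m := by exact_mod_cast hm
  refine ⟨c * ((2 * (m : ℝ)) ^ (2 * m))⁻¹, by positivity, fun ν hν => ?_⟩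
  have hN : 1 ≤ ν / m := (Nat.one_le_div_iff (by omega)).2 hν
  refine le_trans ?_ (h (ν / m) ν hN (Nat.mul_div_le ν m))
  rw [mul_assoc, ← inv_pow, ← mul_pow]
  refine mul_le_mul_of_nonneg_left (pow_le_pow_left₀ (by positivity) ?_ _) hc.le
  rw [inv_mul_le_iff₀ (by positivity)]
  have h1 : ν ≤ 2 * m * (ν / m) := by
    have h2 := Nat.lt_mul_div_succ ν (show 0 < m by omega)
    have h3 : m * 1 ≤ m * (ν / m) := Nat.mul_le_mul_left m hN
    rw [mul_add, mul_one] at h2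
    have h4 : 2 * m * (ν / m) = m * (ν / m) + m * (ν / m) := by ring
    omega
  exact_mod_cast h1

/-- The prior variances are summable against `1 + ρ`. -/
lemma summable_prior_variance (hm : 1 ≤ m) (hφ : M.IsEigenSystem φ ρ) {β : ℝ} (hβ : 1 < β)
    (sd : ℕ → ℝ) : Summable fun ν => (1 + ρ ν) * (tauSq m sd ρ β ν)⁻¹ := by
  obtain ⟨c, hc, h⟩ := exists_rho_ge hm hφ
  have hm0 : (0 : ℝ) < m := by exact_mod_cast hm
  set b : ℝ := β / (2 * (m : ℝ))
  have hb : 0 < b := by positivity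
  have hρm := hφ.rho_pos hm le_rfl
  -- For ν ≥ m, 1 + ρ_ν ≤ (1/ρ_m + 1) ρ_ν cancels the power 1 in τ_ν², leaving ρ_ν^(-b) ≤ c^(-b)
  -- ν^(-β) because 2mb = β.
  refine Summable.of_norm_bounded_eventually_nat
    (g := fun ν : ℕ => ((ρ m)⁻¹ + 1) * (c ^ (-b) * (ν : ℝ) ^ (-β)))
    (((Real.summable_nat_rpow.2 (by linarith)).mul_left _).mul_left _) ?_
  filter_upwards [Filter.eventually_ge_atTop m] with ν hν
  have hν0 : (0 : ℝ) < ν := by exact_mod_cast (by omega : 0 < ν)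
  have hρ := hφ.rho_pos hm hν
  have h1 : (1 + ρ ν) ≤ ((ρ m)⁻¹ + 1) * ρ ν := by
    have : 1 ≤ (ρ m)⁻¹ * ρ ν := by
      rw [← div_eq_inv_mul, one_le_div hρm]
      exact hφ.monotone hν
    linarith
  have h2 : (tauSq m sd ρ β ν)⁻¹ = (ρ ν)⁻¹ * ρ ν ^ (-b) := by
    rw [tauSq, if_neg (by omega), Real.rpow_add hρ, Real.rpow_one, mul_inv, Real.rpow_neg hρ.le]
  have h3 : ρ ν ^ (-b) ≤ c ^ (-b) * (ν : ℝ) ^ (-β) := by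
    refine (Real.rpow_le_rpow_of_nonpos (by positivity) (h ν hν) (by linarith)).trans (le_of_eq ?_)
    rw [Real.mul_rpow hc.le (by positivity), ← Real.rpow_natCast, ← Real.rpow_mul hν0.le]
    congr 2
    simp only [b]
    push_cast
    field_simp
  have h4 : 0 ≤ ρ ν ^ (-b) := (Real.rpow_pos_of_pos hρ _).le
  rw [h2, Real.norm_of_nonneg (by positivity)]
  calc (1 + ρ ν) * ((ρ ν)⁻¹ * ρ ν ^ (-b))
      ≤ ((ρ m)⁻¹ + 1) * ρ ν * ((ρ ν)⁻¹ * ρ ν ^ (-b)) :=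
        mul_le_mul_of_nonneg_right h1 (by positivity)
    _ = ((ρ m)⁻¹ + 1) * ρ ν ^ (-b) := by field_simp
    _ ≤ _ := mul_le_mul_of_nonneg_left h3 (by positivity)

lemma lintegral_sq_of_gaussian {Ω : Type*} [MeasurableSpace Ω] {P : Measure Ω} {X : Ω → ℝ}
    (hX : Measurable X) {s : NNReal} (hlaw : P.map X = gaussianReal 0 s) :
    ∫⁻ ω, ENNReal.ofReal (X ω ^ 2) ∂P = s := by
  have h1 : ∫⁻ ω, ENNReal.ofReal (X ω ^ 2) ∂P
      = ∫⁻ x, ENNReal.ofReal (x ^ 2) ∂(gaussianReal 0 s) := by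
    rw [← hlaw, lintegral_map (by fun_prop) hX]
  have h2 : Integrable (fun x : ℝ => x ^ 2) (gaussianReal 0 s) :=
    (memLp_id_gaussianReal 2).integrable_sq
  rw [h1, ← ofReal_integral_eq_lintegral_ofReal h2 (.of_forall fun x => sq_nonneg x)]
  have h3 := variance_fun_id_gaussianReal (μ := 0) (v := s)
  rw [variance_of_integral_eq_zero (by fun_prop) integral_id_gaussianReal] at h3
  rw [h3]
  simp

/-- A nonnegative random sum with finite expectation is almost surely finite, and its expectation is
∑ r_ν s_ν. -/
lemma ae_summable_of_gaussian {Ω : Type*} [MeasurableSpace Ω] {P : Measure Ω}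
    {v : ℕ → Ω → ℝ} (hv : ∀ ν, Measurable (v ν)) {s r : ℕ → ℝ}
    (hr : ∀ ν, 0 ≤ r ν) (hlaw : ∀ ν, P.map (v ν) = gaussianReal 0 (Real.toNNReal (s ν)))
    (hsum : Summable fun ν => r ν * s ν) : ∀ᵐ ω ∂P, Summable fun ν => r ν * v ν ω ^ 2 := by
  have hmeas : ∀ ν, Measurable fun ω => ENNReal.ofReal (r ν * v ν ω ^ 2) := fun ν => by fun_prop
  have h1 : ∫⁻ ω, ∑' ν, ENNReal.ofReal (r ν * v ν ω ^ 2) ∂P ≠ ⊤ := by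
    rw [lintegral_tsum fun ν => (hmeas ν).aemeasurable]
    have h2 : ∀ ν, ∫⁻ ω, ENNReal.ofReal (r ν * v ν ω ^ 2) ∂P = ENNReal.ofReal (r ν * s ν) := by
      intro ν
      simp_rw [ENNReal.ofReal_mul (hr ν)]
      rw [lintegral_const_mul _ (by fun_prop), lintegral_sq_of_gaussian (hv ν) (hlaw ν)]
      rfl
    simp_rw [h2]
    exact hsum.tsum_ofReal_ne_top
  filter_upwards [ae_lt_top (Measurable.tsum hmeas) h1] with ω hω
  have := ENNReal.summable_toReal hω.ne
  exact this.congr fun ν => by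
    rw [ENNReal.toReal_ofReal (mul_nonneg (hr ν) (sq_nonneg _))]

/-- The coefficient sequences whose eigen-series lie in the Sobolev space. -/
def goodCoef (ρ : ℕ → ℝ) : Set (ℕ → ℝ) := {x | Summable fun ν => (1 + ρ ν) * x ν ^ 2}

lemma measurableSet_goodCoef (hφ : M.IsEigenSystem φ ρ) : MeasurableSet (goodCoef ρ) :=
  measurableSet_summable_nonneg (fun ν => by fun_prop)
    fun ν x => mul_nonneg (by linarith [hφ.rho_nonneg ν]) (sq_nonneg _)

lemma memSobolev_of_mem_goodCoef (hm : 1 ≤ m) (hφ : M.IsEigenSystem φ ρ) {x : ℕ → ℝ}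
    (hx : x ∈ goodCoef ρ) : MemSobolev m (Model.IsEigenSystem.series φ x) :=
  hφ.memSobolev_series hm hx

open Classical in
/-- The eigen-series as an element of the Sobolev space. -/
noncomputable def seriesMap (hm : 1 ≤ m) (hφ : M.IsEigenSystem φ ρ) (x : ℕ → ℝ) : Sobolev m :=
  if h : x ∈ goodCoef ρ then
    ⟨Model.IsEigenSystem.series φ x, memSobolev_of_mem_goodCoef hm hφ h⟩
  else ⟨0, memSobolev_zero m⟩

lemma seriesMap_val_of_mem (hm : 1 ≤ m) (hφ : M.IsEigenSystem φ ρ) {x : ℕ → ℝ}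
    (hx : x ∈ goodCoef ρ) : (seriesMap hm hφ x).1 = Model.IsEigenSystem.series φ x :=
  congrArg Subtype.val (dif_pos hx)

lemma seriesMap_val_of_notMem (hm : 1 ≤ m) (hφ : M.IsEigenSystem φ ρ) {x : ℕ → ℝ}
    (hx : x ∉ goodCoef ρ) : (seriesMap hm hφ x).1 = 0 :=
  congrArg Subtype.val (dif_neg hx)

lemma toSobolev_val_of_memSobolev {Ω : Type*} {X : Ω → I → ℝ} {ω : Ω} (h : MemSobolev m (X ω)) :
    (toSobolev m X ω).1 = X ω :=
  congrArg Subtype.val (dif_pos h)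

lemma measurable_seriesMap (hm : 1 ≤ m) (hφ : M.IsEigenSystem φ ρ) :
    Measurable (seriesMap hm hφ) := by
  refine measurable_sobolev_iff.2 fun t => ?_
  have h1 : (fun x => (seriesMap hm hφ x).1 t)
      = (goodCoef ρ).indicator fun x => ∑' ν, x ν * φ ν t := by
    funext x
    by_cases hx : x ∈ goodCoef ρ
    · rw [indicator_of_mem hx, seriesMap_val_of_mem hm hφ hx]
    · rw [indicator_of_notMem hx, seriesMap_val_of_notMem hm hφ hx]; rfl
  rw [h1]
  exact (Measurable.tsum fun ν => by fun_prop).indicator (measurableSet_goodCoef hφ)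

lemma toSobolev_process_eq (hm : 1 ≤ m) (hφ : M.IsEigenSystem φ ρ) {Ω : Type*}
    {c : ℕ → Ω → ℝ} {ω : Ω} (h : (fun ν => c ν ω) ∈ goodCoef ρ) :
    toSobolev m (process φ c) ω = seriesMap hm hφ fun ν => c ν ω := by
  refine Subtype.ext ?_
  rw [seriesMap_val_of_mem hm hφ h]
  exact toSobolev_val_of_memSobolev (memSobolev_of_mem_goodCoef hm hφ h)

/-- Both induced measures become images of coefficient laws under the same map. The almost sure
identity with the measurable `seriesMap` also avoids proving that {X ∈ S^m} is an event. -/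
lemma inducedMeasure_process (hm : 1 ≤ m) (hφ : M.IsEigenSystem φ ρ) {Ω : Type*}
    [MeasurableSpace Ω] {P : Measure Ω} {c : ℕ → Ω → ℝ} (hc : ∀ ν, Measurable (c ν))
    (h : ∀ᵐ ω ∂P, (fun ν => c ν ω) ∈ goodCoef ρ) :
    inducedMeasure m P (process φ c) = (P.map fun ω ν => c ν ω).map (seriesMap hm hφ) := by
  rw [Measure.map_map (measurable_seriesMap hm hφ) (measurable_pi_lambda _ hc), inducedMeasure]
  refine Measure.map_congr ?_
  filter_upwards [h] with ω hω using toSobolev_process_eq hm hφ hω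

lemma withDensity_map {α β : Type*} [MeasurableSpace α] [MeasurableSpace β] {μ : Measure α}
    {T : α → β} (hT : Measurable T) {F : β → ℝ≥0∞} (hF : Measurable F) :
    (μ.map T).withDensity F = (μ.withDensity (F ∘ T)).map T := by
  ext B hB
  rw [withDensity_apply _ hB, Measure.map_apply hT hB, withDensity_apply _ (hT hB),
    setLIntegral_map hB hF hT]
  rfl

/-- Consequences of a density formula with an unnormalized positive real density. -/
lemma density_consequences {α : Type*} [MeasurableSpace α] {Q R : Measure α}
    [IsProbabilityMeasure Q] [IsProbabilityMeasure R] {F : α → ℝ} (hF : Measurable F)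
    (hF0 : ∀ a, 0 ≤ F a) {z : ℝ≥0∞} (hz : z ≠ 0) (hz' : z ≠ ⊤)
    (h : Q.withDensity (fun a => ENNReal.ofReal (F a)) = z • R) :
    Integrable F Q ∧ 0 < ∫ a, F a ∂Q ∧ R.AbsolutelyContinuous Q ∧
      R.rnDeriv Q =ᵐ[Q] (fun a => ENNReal.ofReal (F a / ∫ b, F b ∂Q)) ∧
      (∫⁻ a, ENNReal.ofReal (F a) ∂Q)⁻¹ • Q.withDensity (fun a => ENNReal.ofReal (F a)) = R := by
  -- Comparing total masses identifies the unknown factor `z` with the normalizing integral.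
  have hint : ∫⁻ a, ENNReal.ofReal (F a) ∂Q = z := by
    have := congrArg (fun μ : Measure α => μ univ) h
    simpa using this
  have hi : Integrable F Q := by
    refine ⟨hF.aestronglyMeasurable, ?_⟩
    rw [hasFiniteIntegral_iff_ofReal (.of_forall hF0), hint]
    exact hz'.lt_top
  have hval : ENNReal.ofReal (∫ a, F a ∂Q) = z := by
    rw [ofReal_integral_eq_lintegral_ofReal hi (.of_forall hF0), hint]
  have hpos : 0 < ∫ a, F a ∂Q := by
    rw [← ENNReal.ofReal_pos, hval]
    exact pos_iff_ne_zero.2 hz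
  have hR : z⁻¹ • Q.withDensity (fun a => ENNReal.ofReal (F a)) = R := by
    rw [h, smul_smul, ENNReal.inv_mul_cancel hz hz', one_smul]
  have hR' : R = Q.withDensity fun a => ENNReal.ofReal (F a / ∫ b, F b ∂Q) := by
    rw [← hR, ← withDensity_smul _ hF.ennreal_ofReal]
    congr 1
    funext a
    rw [Pi.smul_apply, smul_eq_mul, ENNReal.ofReal_div_of_pos hpos, hval, ENNReal.div_eq_inv_mul]
  refine ⟨hi, hpos, ?_, ?_, by rw [hint]; exact hR⟩
  · rw [hR']
    exact withDensity_absolutelyContinuous _ _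
  · conv_lhs => rw [hR']
    exact Measure.rnDeriv_withDensity Q (hF.div_const _).ennreal_ofReal

/-- On eigen-series, the weight `exp (-(n/2) ‖f - q‖²)` is a Gaussian weight of the coefficients. -/
lemma exists_expWeight_seriesMap (hm : 1 ≤ m) (hφ : M.IsEigenSystem φ ρ) (lam : ℝ) (n : ℕ)
    {q : I → ℝ} (hq : MemSobolev m q) : ∃ k : ℝ, 0 < k ∧ ∀ x ∈ goodCoef ρ,
      (Summable fun ν => (n : ℝ) * (1 + lam * gam m ρ ν) * (x ν - M.V q (φ ν)) ^ 2) ∧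
      M.expWeight lam n q (seriesMap hm hφ x) = k * Real.exp (-(1 / 2) *
        ∑' ν, (n : ℝ) * (1 + lam * gam m ρ ν) * (x ν - M.V q (φ ν)) ^ 2) := by
  obtain ⟨K, hK⟩ := hφ.exists_hasSum_normSq_sub hm lam hq
  refine ⟨Real.exp (-((n : ℝ) / 2) * K), Real.exp_pos _, fun x hx => ?_⟩
  have h1 := (hK x hx).mul_left (n : ℝ)
  simp only [← mul_assoc] at h1
  refine ⟨h1.summable, ?_⟩
  rw [h1.tsum_eq, ← Real.exp_add, Model.expWeight, seriesMap_val_of_mem hm hφ hx]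
  congr 1
  ring

end SplineBayes

/-! ### The law of W as the normalized tilted prior -/

theorem mainTheorem3 {m : ℕ} (hm : 1 ≤ m) (M : SplineBayes.Model m)
    -- the eigen-system of the pair of forms `(V, U)`
    (φ : ℕ → unitInterval → ℝ) (ρ : ℕ → ℝ) (hφ : M.IsEigenSystem φ ρ)
    -- the hyper-parameters
    (β lam : ℝ) (hβ : 1 < β) (hlam : 0 < lam) (sd : ℕ → ℝ) (hsd : ∀ ν < m, 0 < sd ν)
    -- the observed sample and the smoothing spline estimate computed from it
    (n : ℕ) (hn : 1 ≤ n) (y : Fin n → ℝ) (x : Fin n → unitInterval)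
    (fhat : unitInterval → ℝ) (hfhat : M.IsSplineEstimate lam y x fhat)
    -- the independent Gaussian coefficients
    {Ω : Type*} [MeasurableSpace Ω] (P : MeasureTheory.Measure Ω)
    [MeasureTheory.IsProbabilityMeasure P]
    (v : ℕ → Ω → ℝ) (hv : ∀ ν, Measurable (v ν)) (hindep : ProbabilityTheory.iIndepFun v P)
    (hlaw : ∀ ν, P.map (v ν)
      = ProbabilityTheory.gaussianReal 0 (Real.toNNReal (SplineBayes.tauSq m sd ρ β ν)⁻¹))
    -- the two induced measures on the Sobolev space
    (Pi PiW : MeasureTheory.Measure (SplineBayes.Sobolev m))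
    (hPi : Pi = SplineBayes.inducedMeasure m P (SplineBayes.process φ v))
    (hPiW : PiW = SplineBayes.inducedMeasure m P
      (SplineBayes.process φ (M.wCoef φ ρ sd β lam n fhat v))) :
    -- both series converge and have paths in the Sobolev space almost surely
    (∀ᵐ ω ∂P, (∀ t, Summable fun ν => v ν ω * φ ν t) ∧
      SplineBayes.MemSobolev m (SplineBayes.process φ v ω)) ∧
    (∀ᵐ ω ∂P, (∀ t, Summable fun ν => M.wCoef φ ρ sd β lam n fhat v ν ω * φ ν t) ∧
      SplineBayes.MemSobolev m
        (SplineBayes.process φ (M.wCoef φ ρ sd β lam n fhat v) ω)) ∧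
    MeasureTheory.IsProbabilityMeasure Pi ∧
    MeasureTheory.IsProbabilityMeasure PiW ∧
    -- the normalizing constant is a well-defined positive number
    Measurable (M.expWeight lam n fhat) ∧
    MeasureTheory.Integrable (M.expWeight lam n fhat) Pi ∧
    0 < ∫ f, M.expWeight lam n fhat f ∂Pi ∧
    -- the Radon-Nikodym derivative of `PiW` with respect to `Pi`
    PiW.AbsolutelyContinuous Pi ∧
    PiW.rnDeriv Pi =ᵐ[Pi] (fun f => ENNReal.ofReal
      (M.expWeight lam n fhat f / ∫ g, M.expWeight lam n fhat g ∂Pi)) ∧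
    -- the pseudo-posterior has the same derivative and is equal to `PiW`
    (M.pseudoPosterior lam n fhat Pi).AbsolutelyContinuous Pi ∧
    (M.pseudoPosterior lam n fhat Pi).rnDeriv Pi =ᵐ[Pi] PiW.rnDeriv Pi ∧
    M.pseudoPosterior lam n fhat Pi = PiW := by
  open SplineBayes in
  have hq := hfhat.1
  have hn0 : (0 : ℝ) < n := by exact_mod_cast hn
  set τ := tauSq m sd ρ β
  have hτ : ∀ ν, 0 < τ ν := tauSq_pos hm hφ hsd β
  set c : ℕ → ℝ := fun ν => (n : ℝ) * (1 + lam * gam m ρ ν)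
  have hc : ∀ ν, 0 < c ν := fun ν => by
    have := mul_nonneg hlam.le (gam_nonneg hφ ν)
    exact mul_pos hn0 (by linarith)
  set w := M.wCoef φ ρ sd β lam n fhat v
  have hweq : ∀ ν ω, w ν ω = c ν / (τ ν + c ν) * M.V fhat (φ ν)
      + (√(τ ν + c ν))⁻¹ * √(τ ν) * v ν ω := fun ν ω => rfl
  have hw : ∀ ν, Measurable (w ν) := fun ν => by
    have : w ν = fun ω => c ν / (τ ν + c ν) * M.V fhat (φ ν)
      + (√(τ ν + c ν))⁻¹ * √(τ ν) * v ν ω := funext (hweq ν)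
    rw [this]
    exact ((hv ν).const_mul _).const_add _
  have hgv : ∀ᵐ ω ∂P, (fun ν => v ν ω) ∈ goodCoef ρ :=
    ae_summable_of_gaussian hv (fun ν => by linarith [hφ.rho_nonneg ν]) hlaw (summable_prior_variance hm hφ hβ sd)
  -- Both a_{n,ν} and b_{n,ν} τ_ν lie in [0,1], so w_ν² ≤ 2 (f̂_ν² + v_ν²); Bessel's inequalities
  -- for `V` and `U` take care of f̂_ν.
  have hgw : ∀ᵐ ω ∂P, (fun ν => w ν ω) ∈ goodCoef ρ := by
    filter_upwards [hgv] with ω hω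
    have h1 : Summable fun ν => (1 + ρ ν) * M.V fhat (φ ν) ^ 2 := by
      simpa only [add_mul, one_mul] using (hφ.bessel_V hm hq).add (hφ.bessel_U hm hq)
    refine Summable.of_nonneg_of_le
      (fun ν => mul_nonneg (by linarith [hφ.rho_nonneg ν]) (sq_nonneg _)) (fun ν => ?_)
      ((h1.add hω).mul_left 2)
    have h0 : 0 < τ ν + c ν := add_pos (hτ ν) (hc ν)
    have ha0 : 0 ≤ c ν / (τ ν + c ν) := div_nonneg (hc ν).le h0.le
    have ha1 : c ν / (τ ν + c ν) ≤ 1 := (div_le_one h0).2 (by linarith [hτ ν])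
    have hb : ((√(τ ν + c ν))⁻¹ * √(τ ν)) ^ 2 ≤ 1 := by
      rw [mul_pow, inv_pow, Real.sq_sqrt h0.le, Real.sq_sqrt (hτ ν).le, inv_mul_le_iff₀ h0]
      linarith [hc ν]
    have h2 : w ν ω ^ 2 ≤ 2 * (M.V fhat (φ ν) ^ 2 + v ν ω ^ 2) := by
      rw [hweq]
      set a := c ν / (τ ν + c ν)
      set b := (√(τ ν + c ν))⁻¹ * √(τ ν)
      have e1 : (a * M.V fhat (φ ν)) ^ 2 ≤ M.V fhat (φ ν) ^ 2 := by
        rw [mul_pow]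
        exact mul_le_of_le_one_left (sq_nonneg _) (pow_le_one₀ ha0 ha1)
      have e2 : (b * v ν ω) ^ 2 ≤ v ν ω ^ 2 := by
        rw [mul_pow]
        exact mul_le_of_le_one_left (sq_nonneg _) hb
      nlinarith [sq_nonneg (a * M.V fhat (φ ν) - b * v ν ω)]
    have h3 : 0 ≤ 1 + ρ ν := by linarith [hφ.rho_nonneg ν]
    calc (1 + ρ ν) * w ν ω ^ 2 ≤ (1 + ρ ν) * (2 * (M.V fhat (φ ν) ^ 2 + v ν ω ^ 2)) :=
          mul_le_mul_of_nonneg_left h2 h3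
      _ = 2 * ((1 + ρ ν) * M.V fhat (φ ν) ^ 2 + (1 + ρ ν) * v ν ω ^ 2) := by ring
  obtain ⟨k, hk, hexp⟩ := exists_expWeight_seriesMap hm hφ lam n hq
  obtain ⟨Z, hZ, hZ', hdens⟩ := withDensity_map_gaussian hv hindep hτ hc
    (f := fun ν => M.V fhat (φ ν)) hlaw
    (by filter_upwards [hgv] with ω hω using (hexp _ hω).1)
  have hPi' := hPi.trans (inducedMeasure_process hm hφ hv hgv)
  have hPiW' := hPiW.trans (inducedMeasure_process hm hφ hw hgw)
  have hT := measurable_seriesMap hm hφ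
  have hvm : Measurable fun ω ν => v ν ω := measurable_pi_lambda _ hv
  have hwm : Measurable fun ω ν => w ν ω := measurable_pi_lambda _ hw
  have hprob : IsProbabilityMeasure Pi := by
    rw [hPi', Measure.map_map hT hvm]
    exact Measure.isProbabilityMeasure_map (hT.comp hvm).aemeasurable
  have hprobW : IsProbabilityMeasure PiW := by
    rw [hPiW', Measure.map_map hT hwm]
    exact Measure.isProbabilityMeasure_map (hT.comp hwm).aemeasurable
  have hmeas := hφ.measurable_expWeight hm lam n hq
  have hgood : ∀ᵐ x ∂(P.map fun ω ν => v ν ω), x ∈ goodCoef ρ :=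
    (ae_map_iff hvm.aemeasurable (measurableSet_goodCoef hφ)).2 hgv
  -- The weight is a function on S^m, so it can be pulled back along `seriesMap` without
  -- injectivity. On good sequences it equals `k` times the Gaussian tilt, and the image of the
  -- tilted law is a multiple of `PiW`.
  have key : Pi.withDensity (fun f => ENNReal.ofReal (M.expWeight lam n fhat f))
      = (ENNReal.ofReal k * Z) • PiW := by
    rw [hPi', withDensity_map hT hmeas.ennreal_ofReal, withDensity_congr_ae
      (g := ENNReal.ofReal k • fun x => ENNReal.ofReal (Real.exp (-(1 / 2) *
        ∑' ν, c ν * (x ν - M.V fhat (φ ν)) ^ 2))) ?_, withDensity_smul' _ _ ENNReal.ofReal_ne_top,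
      hdens, smul_smul, Measure.map_smul, hPiW']
    · rfl
    · filter_upwards [hgood] with x hx
      rw [Function.comp_apply, (hexp x hx).2, ENNReal.ofReal_mul hk.le]
      rfl
  obtain ⟨h1, h2, h3, h4, h5⟩ := density_consequences hmeas
    (fun f => (Real.exp_pos _).le) (mul_ne_zero (ENNReal.ofReal_pos.2 hk).ne' hZ)
    (ENNReal.mul_ne_top ENNReal.ofReal_ne_top hZ') key
  have h6 : M.pseudoPosterior lam n fhat Pi = PiW := h5
  refine ⟨?_, ?_, hprob, hprobW, hmeas, h1, h2, h3, h4, h6 ▸ h3, by rw [h6], h6⟩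
  · filter_upwards [hgv] with ω hω
    exact ⟨hφ.summable_series hm hω, hφ.memSobolev_series hm hω⟩
  · filter_upwards [hgw] with ω hω
    exact ⟨hφ.summable_series hm hω, hφ.memSobolev_series hm hω⟩
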